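/- Let $N\ge 2$, $R>0$, $p\ge 2$, and let $B_R\subset\mathbb{R}^N$ be the open ball of radius $R$ centred at the origin. For $\alpha>0$ put $H_\alpha(\xi)=(|\xi|-1)_+^{\alpha}\,\xi/|\xi|$ for $\xi\in\mathbb{R}^N\setminus\{0\}$ and $H_\alpha(0)=0$. For $f$ on $B_R$ call $u\in W^{1,p}_0(B_R)$ a weak solution of $$-\operatorname{div}\Big((|\nabla u|-1)_+^{p-1}\frac{\nabla u}{|\nabla u|}\Big)=f\ \text{ in } B_R,\qquad u=0\ \text{ on }\partial B_R, \tag{D}$$ if $\int_{B_R}\langle H_{p-1}(\nabla u),\nabla\varphi\rangle\,dx=\int_{B_R}f\varphi\,dx$ for all $\varphi\in C_c^\infty(B_R)$. For $1<r<\infty$, $L^{r,\infty}(B_R)$ is the space of measurable $f$ with $\sup_{t>0}t^{1/r}f^{**}(t)<\infty$, where $f^{**}(t)=\frac1t\int_0^t f^*(s)\,ds$ and $f^*$ is the decreasing rearrangement of $f$. A function on $B_R$ is radially decreasing if it agrees a.e. with a non-increasing function of $|x|\in(0,R)$. Set $$r_0=\frac{Np}{N(p-1)+(2-p)}.$$ (i)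 If $r>r_0$, $f\in L^{r,\infty}(B_R)$ is non-negative and radially decreasing, and $u$ is a weak solution of (D), then $H_{p/2}(\nabla u)\in W^{1,2}(B_R;\mathbb{R}^N)$. (ii) The threshold is sharp: for every $r$ with $1<r\le r_0$ there is $\beta>0$ such that $f(x)=|x|^{-\beta}$ is a non-negative radially decreasing function in $L^{r,\infty}(B_R)$, problem (D) has a weak solution for this $f$, and every weak solution $u$ satisfies $H_{p/2}(\nabla u)\notin W^{1,2}(B_R;\mathbb{R}^N)$. -/

import Mathlib

open MeasureTheory Set Filter Topology
open scoped ENNReal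

noncomputable section

/-- `ℝᴺ` with the Euclidean norm. -/
abbrev RN (N : ℕ) : Type := EuclideanSpace ℝ (Fin N)

/-- The open ball `B_R` of `ℝᴺ` centred at the origin. -/
def openBall (N : ℕ) (R : ℝ) : TopologicalSpace.Opens (RN N) :=
  ⟨Metric.ball 0 R, Metric.isOpen_ball⟩

/-- Lebesgue measure restricted to the open set `Ω`. -/
abbrev leb {N : ℕ} (Ω : TopologicalSpace.Opens (RN N)) : Measure (RN N) :=
  volume.restrict (Ω : Set (RN N))

/-! ### Sobolev spaces -/

/-- `G` is the weak gradient of `u` in `Ω`: both are locally integrable in `Ω` and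
`∫ u ∂ᵢφ = - ∫ Gᵢ φ` for all `φ ∈ C_c^∞(Ω)` and all `i`. -/
def IsWeakGradient {N : ℕ} (Ω : TopologicalSpace.Opens (RN N)) (u : RN N → ℝ)
    (G : RN N → RN N) : Prop :=
  LocallyIntegrableOn u (Ω : Set (RN N)) volume ∧
  LocallyIntegrableOn G (Ω : Set (RN N)) volume ∧
  ∀ (φ : TestFunction Ω ℝ ⊤) (i : Fin N),
    ∫ x in (Ω : Set (RN N)), u x * (gradient φ x) i
      = - ∫ x in (Ω : Set (RN N)), (G x) i * φ x

/-- The Sobolev space `W^{1,q}(Ω)` of real-valued functions. -/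
def MemW1 {N : ℕ} (Ω : TopologicalSpace.Opens (RN N)) (q : ℝ≥0∞) (u : RN N → ℝ) : Prop :=
  MemLp u q (leb Ω) ∧ ∃ G : RN N → RN N, IsWeakGradient Ω u G ∧ MemLp G q (leb Ω)

/-- The Sobolev space `W^{1,q}(Ω; ℝᴺ)` of vector fields. -/
def MemW1Vec {N : ℕ} (Ω : TopologicalSpace.Opens (RN N)) (q : ℝ≥0∞)
    (V : RN N → RN N) : Prop :=
  ∀ i : Fin N, MemW1 Ω q (fun x => (V x) i)

/-- The space `W₀^{1,q}(Ω)`: the functions in `W^{1,q}(Ω)` which are limits in the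
`W^{1,q}(Ω)` norm of functions in `C_c^∞(Ω)`. -/
def MemW1Zero {N : ℕ} (Ω : TopologicalSpace.Opens (RN N)) (q : ℝ≥0∞) (u : RN N → ℝ) : Prop :=
  MemLp u q (leb Ω) ∧
  ∃ G : RN N → RN N, IsWeakGradient Ω u G ∧ MemLp G q (leb Ω) ∧
    ∃ φ : ℕ → TestFunction Ω ℝ ⊤,
      Tendsto (fun n => eLpNorm (fun x => u x - φ n x) q (leb Ω)) atTop (𝓝 0) ∧
      Tendsto (fun n => eLpNorm (fun x => G x - gradient (φ n) x) q (leb Ω)) atTop (𝓝 0)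

/-! ### Weak Lebesgue (Lorentz) spaces `L^{r,∞}` -/

/-- The distribution function `μ_f(τ) = |{x ∈ Ω : |f(x)| > τ}|`. -/
def distribFun {N : ℕ} (Ω : TopologicalSpace.Opens (RN N)) (f : RN N → ℝ) (τ : ℝ≥0∞) : ℝ≥0∞ :=
  leb Ω {x | τ < ‖f x‖ₑ}

/-- The decreasing rearrangement `f*(s) = inf {τ ≥ 0 : μ_f(τ) ≤ s}`. -/
def decRearr {N : ℕ} (Ω : TopologicalSpace.Opens (RN N)) (f : RN N → ℝ) (s : ℝ) : ℝ≥0∞ :=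
  sInf {τ : ℝ≥0∞ | distribFun Ω f τ ≤ ENNReal.ofReal s}

/-- The maximal function `f**(t) = t⁻¹ ∫₀ᵗ f*(s) ds`, for `t > 0`. -/
def maxRearr {N : ℕ} (Ω : TopologicalSpace.Opens (RN N)) (f : RN N → ℝ) (t : ℝ) : ℝ≥0∞ :=
  (ENNReal.ofReal t)⁻¹ * ∫⁻ s in Ioo (0 : ℝ) t, decRearr Ω f s

/-- The norm `‖f‖_{L^{r,∞}(Ω)} = sup_{t > 0} t^{1/r} f**(t)`. -/
def lorentzNorm {N : ℕ} (Ω : TopologicalSpace.Opens (RN N)) (r : ℝ) (f : RN N → ℝ) : ℝ≥0∞ :=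
  ⨆ t ∈ Ioi (0 : ℝ), ENNReal.ofReal (t ^ (1 / r)) * maxRearr Ω f t

/-- The space `L^{r,∞}(Ω)`, for `1 < r < ∞`. -/
def MemLorentz {N : ℕ} (Ω : TopologicalSpace.Opens (RN N)) (r : ℝ) (f : RN N → ℝ) : Prop :=
  AEStronglyMeasurable f (leb Ω) ∧ lorentzNorm Ω r f < ∞

/-- `f` is a non-negative radially decreasing function on `B_R`: almost everywhere in `B_R` it
is a non-negative, non-increasing function of `|x| ∈ (0, R)`.  (The value at the origin is
left free, so that unbounded data such as `|x|^(-β)` are allowed.) -/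
def RadiallyDecreasing (N : ℕ) (R : ℝ) (f : RN N → ℝ) : Prop :=
  ∃ g : ℝ → ℝ, AntitoneOn g (Ioo 0 R) ∧ (∀ s ∈ Ioo 0 R, 0 ≤ g s) ∧
    ∀ᵐ x ∂(leb (openBall N R)), f x = g ‖x‖

/-! ### The widely degenerate equation -/

/-- The field `H_α(ξ) = (|ξ| - 1)₊^α ξ / |ξ|` for `ξ ≠ 0`, and `H_α(0) = 0`. -/
def fieldH {N : ℕ} (α : ℝ) (ξ : RN N) : RN N :=
  if ξ = 0 then 0 else (max (‖ξ‖ - 1) 0 ^ α / ‖ξ‖) • ξ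

/-- `u`, with weak gradient `G`, is a weak solution in `W₀^{1,p}(B_R)` of the Dirichlet problem
`-div ((|∇u| - 1)₊^{p-1} ∇u / |∇u|) = f` in `B_R`, `u = 0` on `∂B_R`. -/
structure IsWeakSolution (N : ℕ) (R p : ℝ) (f : RN N → ℝ) (u : RN N → ℝ)
    (G : RN N → RN N) : Prop where
  mem : MemW1Zero (openBall N R) (ENNReal.ofReal p) u
  grad : IsWeakGradient (openBall N R) u G
  eq : ∀ φ : TestFunction (openBall N R) ℝ ⊤,
    ∫ x in (openBall N R : Set (RN N)), inner ℝ (fieldH (p - 1) (G x)) (gradient φ x)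
      = ∫ x in (openBall N R : Set (RN N)), f x * φ x

end

/-! ### Weak gradients: uniqueness, classical derivatives, closure under `L¹` limits -/

section WeakGradient

variable {N : ℕ} {Ω : TopologicalSpace.Opens (RN N)}

/-! For radial data `f(x) = g(|x|)` the equation can be solved by hand. With the mass `M(ρ) = ∫₀^ρ
s^{N-1} g(s) ds`, the divergence theorem suggests the flux `H_{p-1}(∇u) = -v x/|x|`, where `v =
|x|^{1-N} M(|x|)`. This is realised by the radial function with slope `1 + v^{1/(p-1)}`, and then
`H_{p/2}(∇u) = -v^θ x/|x| = W(|x|) x` with `θ = p/(2(p-1))`.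

Nothing is lost by looking at this one solution. The gradient is not unique where its modulus is at
most one, but monotonicity of `H_{p-1}` determines `H_α(∇u)` for every `α > 0`
(`fieldH_ae_eq_of_integral_inner_eq`). Everything reduces to the explicit field `W(|x|) x`.

For (i), a decreasing `g` in `L^{r,∞}` satisfies `g(s) ≤ C s^{-b}` with `b = N/r`
(`exists_le_rpow_of_memLorentz`), so `|W| ≤ C' ρ^{-1+θ(1-b)}`. Monotonicity of `g` also gives `ρ^N
g(ρ) ≤ N M(ρ)`, which bounds the logarithmic derivative: `|ρ W'| ≤ const · |W|`
(`abs_mul_fluxFactorDeriv_le`). The gradient of the field is thus controlled by `|W|` alone, and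
`|x|^{-1+θ(1-b)}` is square integrable near the origin exactly when `r > r₀`.

For (ii), take `β = N/r₀`. Then `W` is a multiple of `ρ^{-N/2}`, and the divergence of the field is
a nonzero multiple of `|x|^{-N/2}`, which just fails to be in `L²`.

The weak derivatives of these singular fields come from smooth radial approximation, with a
Hardy-type identity (`lintegral_lintegral_Ioo_norm`) controlling the potentials. -/

theorem MeasureTheory.LocallyIntegrableOn.coord {G : RN N → RN N} {s : Set (RN N)}
    {μ : Measure (RN N)}
    (hG : LocallyIntegrableOn G s μ) (i : Fin N) : LocallyIntegrableOn (fun x => G x i) s μ := by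
  intro x hx
  obtain ⟨t, ht, hi⟩ := hG x hx
  exact ⟨t, ht, (EuclideanSpace.proj i : RN N →L[ℝ] ℝ).integrable_comp hi⟩

theorem MeasureTheory.Integrable.coord {G : RN N → RN N} {μ : Measure (RN N)}
    (hG : Integrable G μ) (i : Fin N) : Integrable (fun x => G x i) μ :=
  (EuclideanSpace.proj i : RN N →L[ℝ] ℝ).integrable_comp hG

theorem MeasureTheory.LocallyIntegrableOn.integrable_mul_of_tsupport_subset {f η : RN N → ℝ}
    (hf : LocallyIntegrableOn f (Ω : Set (RN N)) volume) (hη : Continuous η)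
    (hc : HasCompactSupport η) (hs : tsupport η ⊆ Ω) :
    Integrable (fun x => f x * η x) volume := by
  have h1 : IntegrableOn f (tsupport η) volume := hf.integrableOn_compact_subset hs hc
  have h2 : IntegrableOn (fun x => f x * η x) (tsupport η) volume :=
    h1.mul_continuousOn hη.continuousOn hc
  refine (integrableOn_iff_integrable_of_support_subset ?_).1 h2
  intro x hx
  apply subset_tsupport
  rw [Function.mem_support] at hx ⊢
  exact fun h => hx (by simp [h])

theorem gradient_coord (φ : RN N → ℝ) (x : RN N) (i : Fin N) :
    (gradient φ x) i = fderiv ℝ φ x (EuclideanSpace.single i 1) := by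
  rw [← inner_gradient_left, EuclideanSpace.inner_single_right]
  simp

theorem continuous_gradient {φ : RN N → ℝ} (hφ : ContDiff ℝ 1 φ) : Continuous (gradient φ) := by
  unfold gradient
  exact (LinearIsometryEquiv.continuous _).comp (hφ.continuous_fderiv one_ne_zero)

theorem tsupport_gradient_subset (φ : RN N → ℝ) : tsupport (gradient φ) ⊆ tsupport φ := by
  refine (closure_mono ?_).trans (tsupport_fderiv_subset ℝ (f := φ))
  intro x hx
  rw [Function.mem_support] at hx ⊢
  exact fun h => hx (by simp [gradient, h])

namespace TestFunction

theorem contDiff_one (φ : TestFunction Ω ℝ ⊤) : ContDiff ℝ 1 φ :=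
  φ.contDiff.of_le (by exact_mod_cast le_top)

theorem continuous_gradient (φ : TestFunction Ω ℝ ⊤) : Continuous (gradient φ) :=
  _root_.continuous_gradient φ.contDiff_one

theorem hasCompactSupport_gradient (φ : TestFunction Ω ℝ ⊤) : HasCompactSupport (gradient φ) :=
  φ.hasCompactSupport.of_isClosed_subset (isClosed_tsupport _) (tsupport_gradient_subset _)

theorem continuous_gradient_coord (φ : TestFunction Ω ℝ ⊤) (i : Fin N) :
    Continuous (fun x => gradient φ x i) :=
  (EuclideanSpace.proj i : RN N →L[ℝ] ℝ).continuous.comp φ.continuous_gradient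

theorem tsupport_gradient_coord (φ : TestFunction Ω ℝ ⊤) (i : Fin N) :
    tsupport (fun x => gradient φ x i) ⊆ tsupport φ := by
  refine (closure_mono ?_).trans (tsupport_gradient_subset φ)
  intro x hx
  rw [Function.mem_support] at hx ⊢
  exact fun h => hx (by simp [h])

theorem integrable_mul {f : RN N → ℝ} (φ : TestFunction Ω ℝ ⊤)
    (hf : LocallyIntegrableOn f (Ω : Set (RN N)) volume) :
    Integrable (fun x => f x * φ x) volume :=
  hf.integrable_mul_of_tsupport_subset φ.continuous φ.hasCompactSupport φ.tsupport_subset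

theorem integrable_mul_gradient {f : RN N → ℝ} (φ : TestFunction Ω ℝ ⊤) (i : Fin N)
    (hf : LocallyIntegrableOn f (Ω : Set (RN N)) volume) :
    Integrable (fun x => f x * gradient φ x i) volume :=
  hf.integrable_mul_of_tsupport_subset (φ.continuous_gradient_coord i)
    (φ.hasCompactSupport.of_isClosed_subset (isClosed_tsupport _) (φ.tsupport_gradient_coord i))
    ((φ.tsupport_gradient_coord i).trans φ.tsupport_subset)

end TestFunction

namespace IsWeakGradient

theorem congr_ae {u u' : RN N → ℝ} {G G' : RN N → RN N} (h : IsWeakGradient Ω u G)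
    (hu : u =ᵐ[leb Ω] u') (hG : G =ᵐ[leb Ω] G') : IsWeakGradient Ω u' G' := by
  obtain ⟨h1, h2, h3⟩ := h
  refine ⟨?_, ?_, fun φ i => ?_⟩
  · intro x hx
    obtain ⟨t, ht, hi⟩ := h1 x hx
    refine ⟨t ∩ Ω, inter_mem ht self_mem_nhdsWithin, ?_⟩
    refine (hi.mono_set inter_subset_left).congr ?_
    exact ae_mono (Measure.restrict_mono inter_subset_right le_rfl) hu
  · intro x hx
    obtain ⟨t, ht, hi⟩ := h2 x hx
    refine ⟨t ∩ Ω, inter_mem ht self_mem_nhdsWithin, ?_⟩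
    refine (hi.mono_set inter_subset_left).congr ?_
    exact ae_mono (Measure.restrict_mono inter_subset_right le_rfl) hG
  · have e1 : ∫ x in (Ω : Set (RN N)), u' x * (gradient φ x) i
        = ∫ x in (Ω : Set (RN N)), u x * (gradient φ x) i :=
      integral_congr_ae (by filter_upwards [hu] with x hx; rw [hx])
    have e2 : ∫ x in (Ω : Set (RN N)), G' x i * φ x
        = ∫ x in (Ω : Set (RN N)), G x i * φ x :=
      integral_congr_ae (by filter_upwards [hG] with x hx; rw [hx])
    rw [e1, e2, h3]

/-- The fundamental lemma of the calculus of variations, applied to each coordinate of the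
difference. Every gradient produced by an existential can hence be replaced by an explicit one. -/
theorem ae_eq {u : RN N → ℝ} {G G' : RN N → RN N} (h : IsWeakGradient Ω u G)
    (h' : IsWeakGradient Ω u G') : G =ᵐ[leb Ω] G' := by
  have key : ∀ i : Fin N, ∀ᵐ x ∂(leb Ω), G x i - G' x i = 0 := by
    intro i
    have hl := (LocallyIntegrableOn.coord h.2.1 i).sub (LocallyIntegrableOn.coord h'.2.1 i)
    rw [ae_restrict_iff' Ω.isOpen.measurableSet]
    refine Ω.isOpen.ae_eq_zero_of_integral_contDiff_smul_eq_zero hl ?_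
    intro η hη hc hs
    let φ : TestFunction Ω ℝ ⊤ := ⟨η, hη, hc, hs⟩
    have i1 := φ.integrable_mul (LocallyIntegrableOn.coord h.2.1 i)
    have i2 := φ.integrable_mul (LocallyIntegrableOn.coord h'.2.1 i)
    have e := (h.2.2 φ i).symm.trans (h'.2.2 φ i)
    have z : ∀ x, x ∉ (Ω : Set (RN N)) → φ x = 0 := fun x hx =>
      image_eq_zero_of_notMem_tsupport fun hx' => hx (φ.tsupport_subset hx')
    rw [setIntegral_eq_integral_of_forall_compl_eq_zero (fun x hx => by simp [z x hx]),
      setIntegral_eq_integral_of_forall_compl_eq_zero (fun x hx => by simp [z x hx]),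
      neg_inj] at e
    have : ∀ x, η x • (G x i - G' x i) = G x i * φ x - G' x i * φ x := by
      intro x
      change η x * _ = G x i * η x - G' x i * η x
      ring
    calc _ = ∫ x, (G x i * φ x - G' x i * φ x) := integral_congr_ae (.of_forall this)
      _ = 0 := by rw [integral_sub i1 i2, e, sub_self]
  filter_upwards [ae_all_iff.2 key] with x hx
  ext i
  exact sub_eq_zero.1 (hx i)

theorem of_contDiff {u : RN N → ℝ} (hu : ContDiff ℝ 1 u) : IsWeakGradient Ω u (gradient u) := by
  have hcg := continuous_gradient hu
  refine ⟨hu.continuous.locallyIntegrable.locallyIntegrableOn _,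
    hcg.locallyIntegrable.locallyIntegrableOn _, fun φ i => ?_⟩
  have lu : LocallyIntegrableOn u (Ω : Set (RN N)) volume :=
    hu.continuous.locallyIntegrable.locallyIntegrableOn _
  have lg : LocallyIntegrableOn (gradient u) (Ω : Set (RN N)) volume :=
    hcg.locallyIntegrable.locallyIntegrableOn _
  have z : ∀ x, x ∉ (Ω : Set (RN N)) → x ∉ tsupport φ :=
    fun x hx hx' => hx (φ.tsupport_subset hx')
  rw [setIntegral_eq_integral_of_forall_compl_eq_zero (fun x hx => by
      have : gradient φ x i = 0 := image_eq_zero_of_notMem_tsupport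
        (f := fun x => gradient φ x i) fun h => z x hx (φ.tsupport_gradient_coord i h)
      rw [this, mul_zero]),
    setIntegral_eq_integral_of_forall_compl_eq_zero (fun x hx => by
      rw [image_eq_zero_of_notMem_tsupport (z x hx), mul_zero])]
  have i1 := φ.integrable_mul_gradient i lu
  have i2 := φ.integrable_mul (LocallyIntegrableOn.coord lg i)
  simp only [gradient_coord] at i1 i2 ⊢
  exact integral_mul_fderiv_eq_neg_fderiv_mul_of_integrable i2 i1 (φ.integrable_mul lu)
    (fun x _ => (hu.differentiable one_ne_zero) x)
    (fun x _ => (φ.contDiff_one.differentiable one_ne_zero) x)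

end IsWeakGradient

theorem tendsto_integral_mul_of_tendsto_eLpNorm {α : Type*} [MeasurableSpace α] {μ : Measure α}
    {f : α → ℝ} {F : ℕ → α → ℝ} {η : α → ℝ} {C : ℝ} (hη : ∀ x, ‖η x‖ ≤ C)
    (hm : AEStronglyMeasurable η μ) (hf : Integrable f μ) (hF : ∀ n, Integrable (F n) μ)
    (h : Tendsto (fun n => ∫⁻ x, ‖f x - F n x‖ₑ ∂μ) atTop (𝓝 0)) :
    Tendsto (fun n => ∫ x, F n x * η x ∂μ) atTop (𝓝 (∫ x, f x * η x ∂μ)) := by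
  refine tendsto_integral_of_L1 _ (hf.mul_bdd hm (.of_forall hη)).aestronglyMeasurable
    (.of_forall fun n => (hF n).mul_bdd hm (.of_forall hη)) ?_
  have h2 : Tendsto (fun n => (∫⁻ x, ‖f x - F n x‖ₑ ∂μ) * ENNReal.ofReal C) atTop (𝓝 0) := by
    simpa using ENNReal.Tendsto.mul_const h (Or.inr (ENNReal.ofReal_ne_top (r := C)))
  refine tendsto_of_tendsto_of_tendsto_of_le_of_le tendsto_const_nhds h2 (fun _ => zero_le) ?_
  intro n
  dsimp only
  rw [← lintegral_mul_const' _ _ ENNReal.ofReal_ne_top]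
  refine lintegral_mono fun x => ?_
  rw [← sub_mul, enorm_mul, ← enorm_neg, neg_sub]
  gcongr
  rw [← ofReal_norm]
  exact ENNReal.ofReal_le_ofReal (hη x)

/-- Weak gradients are stable under convergence in `L¹`. -/
theorem IsWeakGradient.of_tendsto {u : RN N → ℝ} {G : RN N → RN N} {v : ℕ → RN N → ℝ}
    {V : ℕ → RN N → RN N} (hu : Integrable u (leb Ω)) (hG : Integrable G (leb Ω))
    (hv : ∀ n, Integrable (v n) (leb Ω)) (hV : ∀ n, Integrable (V n) (leb Ω))
    (hw : ∀ n, IsWeakGradient Ω (v n) (V n))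
    (h1 : Tendsto (fun n => ∫⁻ x, ‖u x - v n x‖ₑ ∂(leb Ω)) atTop (𝓝 0))
    (h2 : Tendsto (fun n => ∫⁻ x, ‖G x - V n x‖ₑ ∂(leb Ω)) atTop (𝓝 0)) :
    IsWeakGradient Ω u G := by
  refine ⟨IntegrableOn.locallyIntegrableOn hu, IntegrableOn.locallyIntegrableOn hG,
    fun φ i => ?_⟩
  obtain ⟨C, hC⟩ := (φ.continuous_gradient_coord i).bounded_above_of_compact_support
    (φ.hasCompactSupport.of_isClosed_subset (isClosed_tsupport _) (φ.tsupport_gradient_coord i))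
  obtain ⟨D, hD⟩ := φ.continuous.bounded_above_of_compact_support φ.hasCompactSupport
  have t1 := tendsto_integral_mul_of_tendsto_eLpNorm hC
    (φ.continuous_gradient_coord i).aestronglyMeasurable hu hv h1
  have t2 := tendsto_integral_mul_of_tendsto_eLpNorm hD
    φ.continuous.aestronglyMeasurable (Integrable.coord hG i) (fun n => Integrable.coord (hV n) i)
    (F := fun n x => V n x i) ?_
  · refine tendsto_nhds_unique t1 ?_
    refine (t2.neg).congr fun n => ?_
    rw [(hw n).2.2 φ i]
  · refine tendsto_of_tendsto_of_tendsto_of_le_of_le tendsto_const_nhds h2 (fun _ => zero_le) ?_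
    intro n
    refine lintegral_mono fun x => ?_
    rw [← PiLp.sub_apply, enorm_le_iff_norm_le]
    exact PiLp.norm_apply_le _ i

end WeakGradient

/-! ### Integration of radial functions: density, polar coordinates, Hardy-type identity -/

section RadialMeasure

/-- Smooth functions with compact support in `(0, R)` are dense in `L^q(μ)` for every finite
measure `μ` carried by `(0, R)`. -/
theorem exists_contDiff_tsupport_subset_Ioo_eLpNorm_sub_le {μ : Measure ℝ} [IsFiniteMeasure μ]
    {R : ℝ} (hR : 0 < R) (hμ : μ (Ioo 0 R)ᶜ = 0) {q : ℝ≥0∞} (hq : 1 ≤ q) (hq' : q ≠ ∞)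
    {h : ℝ → ℝ} (hh : MemLp h q μ) {ε : ℝ} (hε : 0 < ε) :
    ∃ k : ℝ → ℝ, ContDiff ℝ (⊤ : ℕ∞) k ∧ tsupport k ⊆ Ioo 0 R ∧
      eLpNorm (h - k) q μ ≤ ENNReal.ofReal ε := by
  -- Absolute continuity of the `L^q` norm: `h` is small off a compact `K` exhausting `(0, R)` up to
  -- measure `δ`. A cutoff equal to one on `K` therefore costs at most `ε/2`.
  obtain ⟨δ, hδ, hind⟩ := hh.eLpNorm_indicator_le hq hq' (half_pos hε)
  have hball : Ioo 0 R = Metric.ball (R / 2) (R / 2) := by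
    rw [Real.ball_eq_Ioo]; congr 1 <;> ring
  obtain ⟨K, hKs, hKc, hK⟩ : ∃ K ⊆ Ioo 0 R, IsCompact K ∧ μ Kᶜ ≤ ENNReal.ofReal δ := by
    have hK : ∃ K ⊆ Ioo 0 R, IsCompact K ∧ μ (Ioo 0 R \ K) < ENNReal.ofReal δ :=
      measurableSet_Ioo.exists_isCompact_sdiff_lt (measure_ne_top _ _)
        (ENNReal.ofReal_pos.2 hδ).ne'
    obtain ⟨K, h1, h2, h3⟩ := hK
    refine ⟨K, h1, h2, ?_⟩
    calc μ Kᶜ ≤ μ ((Ioo 0 R \ K) ∪ (Ioo 0 R)ᶜ) := measure_mono fun x hx => by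
            by_cases hx' : x ∈ Ioo 0 R
            · exact Or.inl ⟨hx', hx⟩
            · exact Or.inr hx'
      _ ≤ μ (Ioo 0 R \ K) + μ (Ioo 0 R)ᶜ := measure_union_le _ _
      _ ≤ _ := by rw [hμ, add_zero]; exact h3.le
  rw [hball] at hKs
  obtain ⟨r, hr0, hrR, hKr⟩ : ∃ r, 0 < r ∧ r < R / 2 ∧ K ⊆ Metric.closedBall (R / 2) r := by
    obtain ⟨r, hr, hKr⟩ := exists_lt_subset_ball hKc.isClosed hKs
    -- A bump function needs a positive inner radius, and `r` may fail to be positive when `K` is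
    -- empty.
    refine ⟨max r (R / 4), lt_max_of_lt_right (by positivity), max_lt hr (by linarith), ?_⟩
    exact hKr.trans (Metric.ball_subset_closedBall.trans
      (Metric.closedBall_subset_closedBall (le_max_left _ _)))
  let χ : ContDiffBump (R / 2) := ⟨r, (r + R / 2) / 2, hr0, by linarith⟩
  obtain ⟨k, -, hk, hkε⟩ := hh.exist_eLpNorm_sub_le hq' hq (half_pos hε)
  refine ⟨fun s => χ s * k s, χ.contDiff.mul hk, ?_, ?_⟩
  · refine (tsupport_mul_subset_left (f := χ) (g := k)).trans ?_
    rw [χ.tsupport_eq, hball]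
    exact Metric.closedBall_subset_ball (by change (r + R / 2) / 2 < R / 2; linarith)
  · have hχ : AEStronglyMeasurable χ μ := χ.continuous.aestronglyMeasurable
    have hkm : AEStronglyMeasurable k μ := hk.continuous.aestronglyMeasurable
    have e : (h - fun s => χ s * k s) = (fun s => (1 - χ s) * h s) + fun s => χ s * (h - k) s := by
      funext s
      simp only [Pi.sub_apply, Pi.add_apply]
      ring
    rw [e]
    refine (eLpNorm_add_le ((aestronglyMeasurable_const.sub hχ).mul hh.1)
      (hχ.mul (hh.1.sub hkm)) hq).trans ?_
    rw [← add_halves ε, ENNReal.ofReal_add (half_pos hε).le (half_pos hε).le]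
    refine add_le_add ((eLpNorm_mono fun s => ?_).trans
      (hind Kᶜ hKc.isClosed.measurableSet.compl hK)) ((eLpNorm_mono fun s => ?_).trans hkε)
    · change ‖(1 - χ s) * h s‖ ≤ _
      by_cases hs : s ∈ K
      · rw [χ.one_of_mem_closedBall (hKr hs)]
        simp
      · rw [indicator_of_mem (by exact hs), norm_mul]
        refine mul_le_of_le_one_left (norm_nonneg _) ?_
        rw [Real.norm_eq_abs, abs_le]
        constructor <;> linarith [χ.nonneg' s, χ.le_one (x := s)]
    · change ‖χ s * (h - k) s‖ ≤ _
      rw [norm_mul]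
      refine mul_le_of_le_one_left (norm_nonneg _) ?_
      rw [Real.norm_eq_abs, abs_le]
      constructor <;> linarith [χ.nonneg' s, χ.le_one (x := s)]

variable {N : ℕ}

theorem coe_openBall (R : ℝ) : (openBall N R : Set (RN N)) = Metric.ball 0 R := rfl

instance isFiniteMeasure_leb_openBall (R : ℝ) : IsFiniteMeasure (leb (openBall N R)) :=
  ⟨by rw [Measure.restrict_apply_univ]; exact measure_ball_lt_top⟩

theorem ae_mem_openBall (R : ℝ) : ∀ᵐ x ∂(leb (openBall N R)), ‖x‖ < R := by
  filter_upwards [ae_restrict_mem (openBall N R).isOpen.measurableSet] with x hx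
  simpa [coe_openBall] using hx

theorem ae_norm_mem_Ioo (hN : N ≠ 0) (R : ℝ) : ∀ᵐ x ∂(leb (openBall N R)), ‖x‖ ∈ Ioo 0 R := by
  have : Nonempty (Fin N) := ⟨⟨0, Nat.pos_of_ne_zero hN⟩⟩
  have h0 : ∀ᵐ x ∂(leb (openBall N R)), x ≠ 0 :=
    ae_restrict_of_ae (Measure.ae_ne volume (0 : RN N))
  filter_upwards [ae_mem_openBall R, h0] with x hx hx0 using ⟨norm_pos_iff.2 hx0, hx⟩

/-- The one-dimensional density result for the image of Lebesgue measure under `x ↦ |x|`, a finite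
measure carried by `(0, R)`. -/
theorem exists_radial_contDiff_eLpNorm_sub_le (hN : N ≠ 0) {R : ℝ} (hR : 0 < R) {q : ℝ≥0∞}
    (hq : 1 ≤ q) (hq' : q ≠ ∞) {h : ℝ → ℝ} (hm : Measurable h)
    (hh : MemLp (fun x : RN N => h ‖x‖) q (leb (openBall N R))) {ε : ℝ} (hε : 0 < ε) :
    ∃ k : ℝ → ℝ, ContDiff ℝ (⊤ : ℕ∞) k ∧ tsupport k ⊆ Ioo 0 R ∧
      eLpNorm (fun x : RN N => h ‖x‖ - k ‖x‖) q (leb (openBall N R)) ≤ ENNReal.ofReal ε := by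
  have hn : AEMeasurable (fun x : RN N => ‖x‖) (leb (openBall N R)) := measurable_norm.aemeasurable
  have hμ : Measure.map (fun x : RN N => ‖x‖) (leb (openBall N R)) (Ioo 0 R)ᶜ = 0 := by
    rw [Measure.map_apply_of_aemeasurable hn measurableSet_Ioo.compl]
    exact ae_norm_mem_Ioo hN R
  have hh' : MemLp h q (Measure.map (fun x : RN N => ‖x‖) (leb (openBall N R))) :=
    (memLp_map_measure_iff hm.aestronglyMeasurable hn).2 hh
  obtain ⟨k, h1, h2, h3⟩ := exists_contDiff_tsupport_subset_Ioo_eLpNorm_sub_le hR hμ hq hq' hh' hε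
  refine ⟨k, h1, h2, ?_⟩
  rwa [eLpNorm_map_measure (hm.aestronglyMeasurable.sub h1.continuous.aestronglyMeasurable) hn]
    at h3

/-- Integration in polar coordinates of a radial function. -/
theorem lintegral_norm_openBall (hN : N ≠ 0) (R : ℝ) {F : ℝ → ℝ≥0∞} (hF : Measurable F) :
    ∫⁻ x, F ‖x‖ ∂(leb (openBall N R)) = (N * volume (Metric.ball (0 : RN N) 1)) *
      ∫⁻ s in Ioo 0 R, ENNReal.ofReal (s ^ (N - 1)) * F s := by
  have : Nonempty (Fin N) := ⟨⟨0, Nat.pos_of_ne_zero hN⟩⟩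
  have hF' : Measurable ((Iio R).indicator F) := hF.indicator measurableSet_Iio
  have e0 : ∫⁻ x, F ‖x‖ ∂(leb (openBall N R)) = ∫⁻ x : RN N, (Iio R).indicator F ‖x‖ := by
    rw [← lintegral_indicator (openBall N R).isOpen.measurableSet]
    congr 1 with x
    simp only [indicator, coe_openBall, Metric.mem_ball, dist_zero_right, mem_Iio]
  have hmp := (volume : Measure (RN N)).measurePreserving_homeomorphUnitSphereProd
  have hfr : Module.finrank ℝ (RN N) = N := finrank_euclideanSpace_fin
  calc ∫⁻ x, F ‖x‖ ∂(leb (openBall N R))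
      = ∫⁻ x : ({(0)}ᶜ : Set (RN N)), (Iio R).indicator F ‖x.1‖
          ∂((volume : Measure (RN N)).comap (↑)) := by
        rw [e0, lintegral_subtype_comap (measurableSet_singleton _).compl
          (fun x : RN N => (Iio R).indicator F ‖x‖), restrict_compl_singleton]
    _ = ∫⁻ x, (Iio R).indicator F x.2 ∂((volume : Measure (RN N)).toSphere.prod
          (.volumeIoiPow (Module.finrank ℝ (RN N) - 1))) := by
        rw [← hmp.lintegral_comp (f := fun x => (Iio R).indicator F x.2)
          (hF'.comp (measurable_subtype_coe.comp measurable_snd))]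
        simp only [homeomorphUnitSphereProd_apply_snd_coe]
    _ = (volume : Measure (RN N)).toSphere univ * ∫⁻ x : Ioi (0 : ℝ), (Iio R).indicator F x
          ∂(.volumeIoiPow (Module.finrank ℝ (RN N) - 1)) := by
        rw [lintegral_prod (fun x : Metric.sphere (0 : RN N) 1 × Ioi (0 : ℝ) => (Iio R).indicator F x.2)
          (hF'.comp (measurable_subtype_coe.comp measurable_snd)).aemeasurable]
        simp [mul_comm]
    _ = _ := by
        rw [Measure.toSphere_apply_univ, hfr, Measure.volumeIoiPow,
          lintegral_withDensity_eq_lintegral_mul (f := fun r : Ioi (0 : ℝ) => ENNReal.ofReal (r.1 ^ (N - 1))) _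
            (ENNReal.measurable_ofReal.comp (measurable_subtype_coe.pow_const _))
            (g := fun x : Ioi (0 : ℝ) => (Iio R).indicator F x) (hF'.comp measurable_subtype_coe)]
        congr 1
        simp only [Pi.mul_apply]
        rw [lintegral_subtype_comap measurableSet_Ioi
          (fun a : ℝ => ENNReal.ofReal (a ^ (N - 1)) * (Iio R).indicator F a),
          ← lintegral_indicator measurableSet_Ioi, ← lintegral_indicator measurableSet_Ioo]
        congr 1 with s
        by_cases h1 : 0 < s <;> by_cases h2 : s < R <;> simp [indicator, h1, h2]

/-- Tonelli: for fixed `s` the points with `|x| < s` fill a ball of volume `ω s^N`, and `s^N = s ·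
s^{N-1}` recovers the polar density with the extra weight `s`. The gain of this weight is what
allows densities that are singular at the origin. -/
theorem lintegral_lintegral_Ioo_norm (hN : N ≠ 0) (R : ℝ) {K : ℝ → ℝ≥0∞} (hK : Measurable K) :
    ∫⁻ x, (∫⁻ s in Ioo ‖x‖ R, K s) ∂(leb (openBall N R)) =
      (N : ℝ≥0∞)⁻¹ * ∫⁻ x, ENNReal.ofReal ‖x‖ * K ‖x‖ ∂(leb (openBall N R)) := by
  have : Nonempty (Fin N) := ⟨⟨0, Nat.pos_of_ne_zero hN⟩⟩
  have hm : Measurable (fun z : RN N × ℝ => (Ioi ‖z.1‖).indicator K z.2) := by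
    have : (fun z : RN N × ℝ => (Ioi ‖z.1‖).indicator K z.2)
        = {z : RN N × ℝ | ‖z.1‖ < z.2}.indicator (fun z => K z.2) := by
      funext z; simp [indicator]
    rw [this]
    exact (hK.comp measurable_snd).indicator
      (measurableSet_lt (measurable_norm.comp measurable_fst) measurable_snd)
  have e1 : ∀ x : RN N, ∫⁻ s in Ioo ‖x‖ R, K s
      = ∫⁻ s in Ioo 0 R, (Ioi ‖x‖).indicator K s := by
    intro x
    rw [lintegral_indicator measurableSet_Ioi, Measure.restrict_restrict measurableSet_Ioi]
    congr 2
    ext s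
    simp only [mem_inter_iff, mem_Ioo, mem_Ioi]
    exact ⟨fun h => ⟨h.1, (norm_nonneg x).trans_lt h.1, h.2⟩, fun h => ⟨h.1, h.2.2⟩⟩
  have e2 : ∀ s ∈ Ioo 0 R, ∫⁻ x, (Ioi ‖x‖).indicator K s ∂(leb (openBall N R))
      = volume (Metric.ball (0 : RN N) 1) * (ENNReal.ofReal (s ^ (N - 1))
        * (ENNReal.ofReal s * K s)) := by
    intro s hs
    have : ∀ x : RN N, (Ioi ‖x‖).indicator K s = (Metric.ball (0 : RN N) s).indicator
        (fun _ => K s) x := by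
      intro x; simp [indicator]
    simp_rw [this]
    rw [lintegral_indicator Metric.isOpen_ball.measurableSet, lintegral_const,
      Measure.restrict_apply_univ, Measure.restrict_apply Metric.isOpen_ball.measurableSet,
      coe_openBall, inter_eq_left.2 (Metric.ball_subset_ball hs.2.le),
      Measure.addHaar_ball _ _ hs.1.le, finrank_euclideanSpace_fin, ← mul_assoc (ENNReal.ofReal _),
      ← ENNReal.ofReal_mul (pow_nonneg hs.1.le _), pow_sub_one_mul hN]
    ring
  simp_rw [e1]
  rw [lintegral_lintegral_swap hm.aemeasurable, setLIntegral_congr_fun measurableSet_Ioo e2,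
    lintegral_const_mul' _ _ measure_ball_lt_top.ne, lintegral_norm_openBall hN R
      (F := fun s => ENNReal.ofReal s * K s) (by fun_prop)]
  rw [← mul_assoc, ← mul_assoc, ENNReal.inv_mul_cancel (by simpa using hN) (by simp), one_mul]

theorem lintegral_rpow_le_measure_rpow_mul {α : Type*} [MeasurableSpace α] {μ : Measure α}
    {K : α → ℝ≥0∞} (hK : Measurable K) {q : ℝ} (hq : 1 ≤ q) :
    (∫⁻ s, K s ∂μ) ^ q ≤ μ univ ^ (q - 1) * ∫⁻ s, K s ^ q ∂μ := by
  rcases hq.eq_or_lt with rfl | hq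
  · simp
  have hc := Real.HolderConjugate.conjExponent hq
  have h := ENNReal.lintegral_mul_le_Lp_mul_Lq μ hc hK.aemeasurable
    (aemeasurable_const (b := (1 : ℝ≥0∞)))
  simp only [Pi.mul_apply, mul_one, ENNReal.one_rpow, lintegral_const, one_mul] at h
  have hq0 : 0 < q := by linarith
  calc (∫⁻ s, K s ∂μ) ^ q
      ≤ ((∫⁻ s, K s ^ q ∂μ) ^ (1 / q) * μ univ ^ (1 / q.conjExponent)) ^ q := by gcongr
    _ = _ := by
      rw [ENNReal.mul_rpow_of_nonneg _ _ hq0.le, ← ENNReal.rpow_mul, ← ENNReal.rpow_mul,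
        one_div_mul_cancel hq0.ne', ENNReal.rpow_one, mul_comm]
      congr 2
      rw [Real.conjExponent]
      field_simp

/-- A radial Poincaré inequality: Hölder on an interval of length at most `R`, followed by the
preceding identity with the weight `|x|` bounded by `R`. -/
theorem lintegral_lintegral_Ioo_norm_rpow_le (hN : N ≠ 0) (R : ℝ) {K : ℝ → ℝ≥0∞}
    (hK : Measurable K) {q : ℝ} (hq : 1 ≤ q) :
    ∫⁻ x, (∫⁻ s in Ioo ‖x‖ R, K s) ^ q ∂(leb (openBall N R)) ≤
      ENNReal.ofReal R ^ q * ∫⁻ x, K ‖x‖ ^ q ∂(leb (openBall N R)) := by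
  have hK' : Measurable fun s => K s ^ q := hK.pow_const q
  calc ∫⁻ x, (∫⁻ s in Ioo ‖x‖ R, K s) ^ q ∂(leb (openBall N R))
      ≤ ∫⁻ x, (ENNReal.ofReal R ^ (q - 1) * ∫⁻ s in Ioo ‖x‖ R, K s ^ q) ∂(leb (openBall N R)) := by
        refine lintegral_mono fun x => (lintegral_rpow_le_measure_rpow_mul hK hq).trans ?_
        gcongr
        · rw [Measure.restrict_apply_univ, Real.volume_Ioo]
          exact ENNReal.ofReal_le_ofReal (by linarith [norm_nonneg x])
    _ = ENNReal.ofReal R ^ (q - 1) * ((N : ℝ≥0∞)⁻¹ *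
          ∫⁻ x, ENNReal.ofReal ‖x‖ * K ‖x‖ ^ q ∂(leb (openBall N R))) := by
        rw [lintegral_const_mul' _ _ (by simp; intro; linarith), lintegral_lintegral_Ioo_norm hN R hK']
    _ ≤ ENNReal.ofReal R ^ (q - 1) * (1 *
          ∫⁻ x, ENNReal.ofReal R * K ‖x‖ ^ q ∂(leb (openBall N R))) := by
        gcongr _ * (?_ * ?_)
        · rw [ENNReal.inv_le_one]
          exact_mod_cast Nat.pos_of_ne_zero hN
        · refine lintegral_mono_ae ?_
          filter_upwards [ae_mem_openBall R] with x hx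
          gcongr
    _ = _ := by
        rw [one_mul, lintegral_const_mul' _ _ ENNReal.ofReal_ne_top, ← mul_assoc]
        congr 1
        rcases le_or_gt R 0 with h | h
        · rw [ENNReal.ofReal_of_nonpos h, mul_zero, ENNReal.zero_rpow_of_pos (by linarith)]
        · nth_rw 2 [← ENNReal.rpow_one (ENNReal.ofReal R)]
          rw [← ENNReal.rpow_add _ _ (by simpa using h) ENNReal.ofReal_ne_top, sub_add_cancel]

end RadialMeasure

/-! ### Radial potentials as elements of `W₀^{1,q}` -/

section RadialPotential

variable {N : ℕ}

/-- The radial function `x ↦ ∫_{|x|}^R k(s) ds`. -/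
noncomputable def radialPotential (R : ℝ) (k : ℝ → ℝ) (x : RN N) : ℝ := ∫ s in ‖x‖..R, k s

theorem hasGradientAt_norm {x : RN N} (hx : x ≠ 0) :
    HasGradientAt (fun y : RN N => ‖y‖) (‖x‖⁻¹ • x) x := by
  have hx' : ‖x‖ ≠ 0 := norm_ne_zero_iff.2 hx
  have h1 : HasFDerivAt (fun y : RN N => ‖y‖ ^ 2) (2 • innerSL ℝ x) x :=
    (hasStrictFDerivAt_norm_sq x).hasFDerivAt
  have h2 := h1.sqrt (pow_ne_zero 2 hx')
  simp only [Real.sqrt_sq (norm_nonneg _)] at h2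
  rw [hasGradientAt_iff_hasFDerivAt]
  refine h2.congr_fderiv ?_
  ext v
  simp
  field_simp

theorem exists_pos_eq_zero_of_tsupport_subset_Ioo {R : ℝ} {k : ℝ → ℝ}
    (hs : tsupport k ⊆ Ioo 0 R) : ∃ a > 0, (∀ s ≤ a, k s = 0) ∧ ∀ s, R - a ≤ s → k s = 0 := by
  have h0 : (0 : ℝ) ∉ tsupport k := fun h => lt_irrefl _ (hs h).1
  have hR : R ∉ tsupport k := fun h => lt_irrefl _ (hs h).2
  rw [notMem_tsupport_iff_eventuallyEq, Filter.EventuallyEq, Metric.eventually_nhds_iff] at h0 hR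
  obtain ⟨a, ha, h0⟩ := h0
  obtain ⟨b, hb, hR⟩ := hR
  have hz : ∀ s, s ∉ Ioo 0 R → k s = 0 := fun s h =>
    image_eq_zero_of_notMem_tsupport fun h' => h (hs h')
  refine ⟨min a b / 2, by positivity, fun s h => ?_, fun s h => ?_⟩
  · by_cases hs0 : 0 < s
    · refine h0 ?_
      rw [Real.dist_eq, sub_zero, abs_of_pos hs0]
      linarith [min_le_left a b, lt_min ha hb]
    · exact hz s fun h' => hs0 h'.1
  · by_cases hsR : s < R
    · refine hR ?_
      rw [Real.dist_eq, abs_of_neg (by linarith)]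
      linarith [min_le_right a b, lt_min ha hb]
    · exact hz s fun h' => hsR h'.2

theorem hasDerivAt_integral_left {k : ℝ → ℝ} (hk : Continuous k) (R ρ : ℝ) :
    HasDerivAt (fun t => ∫ s in t..R, k s) (-k ρ) ρ :=
  intervalIntegral.integral_hasDerivAt_left (hk.intervalIntegrable _ _)
    (hk.stronglyMeasurableAtFilter _ _) hk.continuousAt

/-- The density vanishes near zero. This is what makes the potential smooth at the origin, the only
point where the norm is not. -/
theorem radialPotential_eventuallyEq_const {R : ℝ} {k : ℝ → ℝ} (hk : Continuous k)
    (hs : tsupport k ⊆ Ioo 0 R) :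
    radialPotential R k =ᶠ[𝓝 (0 : RN N)] fun _ => ∫ s in (0 : ℝ)..R, k s := by
  obtain ⟨a, ha, h0, -⟩ := exists_pos_eq_zero_of_tsupport_subset_Ioo hs
  filter_upwards [Metric.ball_mem_nhds (0 : RN N) ha] with x hx
  rw [mem_ball_zero_iff] at hx
  have hz : ∫ s in (0 : ℝ)..‖x‖, k s = 0 := by
    rw [intervalIntegral.integral_congr (g := fun _ => (0 : ℝ)), intervalIntegral.integral_zero]
    intro s hs
    rw [uIcc_of_le (norm_nonneg _)] at hs
    exact h0 s (hs.2.trans hx.le)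
  rw [radialPotential, ← intervalIntegral.integral_add_adjacent_intervals
    (hk.intervalIntegrable 0 ‖x‖) (hk.intervalIntegrable ‖x‖ R), hz, zero_add]

theorem contDiff_radialPotential {R : ℝ} {k : ℝ → ℝ} (hk : ContDiff ℝ (⊤ : ℕ∞) k)
    (hs : tsupport k ⊆ Ioo 0 R) : ContDiff ℝ (⊤ : ℕ∞) (radialPotential R k : RN N → ℝ) := by
  have hP : ContDiff ℝ (⊤ : ℕ∞) (fun t => ∫ s in t..R, k s) := by
    rw [contDiff_infty_iff_deriv]
    refine ⟨fun ρ => (hasDerivAt_integral_left hk.continuous R ρ).differentiableAt, ?_⟩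
    rw [show deriv (fun t => ∫ s in t..R, k s) = fun ρ => -k ρ from
      funext fun ρ => (hasDerivAt_integral_left hk.continuous R ρ).deriv]
    exact hk.neg
  rw [contDiff_iff_contDiffAt]
  intro x
  by_cases hx : x = 0
  · subst hx
    exact contDiffAt_const.congr_of_eventuallyEq
      (radialPotential_eventuallyEq_const hk.continuous hs)
  · exact hP.contDiffAt.comp x (contDiffAt_norm ℝ hx)

theorem hasGradientAt_radialPotential {R : ℝ} {k : ℝ → ℝ} (hk : Continuous k)
    (hs : tsupport k ⊆ Ioo 0 R) (x : RN N) :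
    HasGradientAt (radialPotential R k) ((-k ‖x‖ / ‖x‖) • x) x := by
  by_cases hx : x = 0
  · subst hx
    rw [smul_zero]
    exact (hasGradientAt_const 0 _).congr_of_eventuallyEq
      (radialPotential_eventuallyEq_const hk hs)
  · have h := (hasDerivAt_integral_left hk R ‖x‖).comp_hasFDerivAt x
      (hasGradientAt_iff_hasFDerivAt.1 (hasGradientAt_norm hx))
    rw [hasGradientAt_iff_hasFDerivAt]
    refine h.congr_fderiv ?_
    simp only [div_eq_mul_inv, mul_smul, map_smul]

/-- The potential of a smooth density with compact support in `(0, R)` is a test function. -/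
noncomputable def radialTestFunction {R : ℝ} {k : ℝ → ℝ} (hk : ContDiff ℝ (⊤ : ℕ∞) k)
    (hs : tsupport k ⊆ Ioo 0 R) : TestFunction (openBall N R) ℝ ⊤ :=
  have h : ∃ b < R, tsupport (radialPotential R k : RN N → ℝ) ⊆ Metric.closedBall 0 b := by
    obtain ⟨a, ha, -, hb⟩ := exists_pos_eq_zero_of_tsupport_subset_Ioo hs
    refine ⟨R - a, by linarith, closure_minimal (fun x hx => ?_) Metric.isClosed_closedBall⟩
    rw [mem_closedBall_zero_iff]
    by_contra! h
    refine hx ?_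
    change ∫ s in ‖x‖..R, k s = 0
    rw [intervalIntegral.integral_congr (g := fun _ => (0 : ℝ)), intervalIntegral.integral_zero]
    intro s hs
    refine hb s (le_trans ?_ hs.1)
    exact le_min h.le (by linarith)
  { toFun := radialPotential R k
    contDiff' := contDiff_radialPotential hk hs
    hasCompactSupport' := by
      obtain ⟨b, -, hb⟩ := h
      exact (isCompact_closedBall _ _).of_isClosed_subset (isClosed_tsupport _) hb
    tsupport_subset' := by
      obtain ⟨b, hbR, hb⟩ := h
      exact hb.trans (Metric.closedBall_subset_ball hbR) }

theorem gradient_radialTestFunction {R : ℝ} {k : ℝ → ℝ} (hk : ContDiff ℝ (⊤ : ℕ∞) k)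
    (hs : tsupport k ⊆ Ioo 0 R) (x : RN N) :
    gradient (radialTestFunction hk hs : RN N → ℝ) x = (-k ‖x‖ / ‖x‖) • x :=
  (hasGradientAt_radialPotential hk.continuous hs x).gradient

theorem enorm_radialPotential_sub_le {R : ℝ} {h k : ℝ → ℝ} (hm : Measurable h)
    (hk : Continuous k) {x : RN N} (hx : ‖x‖ ≤ R) (hfin : ∫⁻ s in Ioo ‖x‖ R, ‖h s‖ₑ < ∞) :
    ‖radialPotential R h x - radialPotential R k x‖ₑ ≤ ∫⁻ s in Ioo ‖x‖ R, ‖h s - k s‖ₑ := by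
  have hi : IntervalIntegrable h volume ‖x‖ R := by
    rw [intervalIntegrable_iff_integrableOn_Ioo_of_le hx]
    exact ⟨hm.aestronglyMeasurable, hfin⟩
  rw [radialPotential, radialPotential, ← intervalIntegral.integral_sub hi
    (hk.intervalIntegrable _ _), intervalIntegral.integral_of_le hx, integral_Ioc_eq_integral_Ioo]
  exact enorm_integral_le_lintegral_enorm _

theorem aestronglyMeasurable_radialPotential {R : ℝ} {h : ℝ → ℝ} (hm : Measurable h) :
    AEStronglyMeasurable (radialPotential R h : RN N → ℝ) (leb (openBall N R)) := by
  have hS : MeasurableSet {z : RN N × ℝ | ‖z.1‖ < z.2 ∧ z.2 < R} :=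
    (measurableSet_lt (measurable_norm.comp measurable_fst) measurable_snd).inter
      (measurableSet_lt measurable_snd measurable_const)
  have h1 : StronglyMeasurable ({z : RN N × ℝ | ‖z.1‖ < z.2 ∧ z.2 < R}.indicator
      fun z => h z.2) :=
    ((hm.comp measurable_snd).indicator hS).stronglyMeasurable
  have h2 := h1.integral_prod_right' (ν := (volume : Measure ℝ))
  refine h2.aestronglyMeasurable.congr ?_
  filter_upwards [ae_mem_openBall R] with x hx
  rw [radialPotential, intervalIntegral.integral_of_le hx.le, integral_Ioc_eq_integral_Ioo,
    ← integral_indicator measurableSet_Ioo]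
  congr 1

theorem eLpNorm_radialPotential_sub_le (hN : N ≠ 0) {R : ℝ} {q : ℝ} (hq : 1 ≤ q)
    {h k : ℝ → ℝ} (hm : Measurable h) (hk : Continuous k)
    (hfin : ∀ᵐ x ∂(leb (openBall N R)), ∫⁻ s in Ioo ‖x‖ R, ‖h s‖ₑ < ∞) :
    eLpNorm (fun x : RN N => radialPotential R h x - radialPotential R k x) (ENNReal.ofReal q)
      (leb (openBall N R)) ≤ ENNReal.ofReal R *
    eLpNorm (fun x : RN N => h ‖x‖ - k ‖x‖) (ENNReal.ofReal q) (leb (openBall N R)) := by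
  have hq0 : 0 < q := by linarith
  have hqn : ENNReal.ofReal q ≠ 0 := by simpa using hq0
  rw [eLpNorm_eq_lintegral_rpow_enorm_toReal hqn ENNReal.ofReal_ne_top,
    eLpNorm_eq_lintegral_rpow_enorm_toReal hqn ENNReal.ofReal_ne_top,
    ENNReal.toReal_ofReal hq0.le]
  have hm' : Measurable fun s => ‖h s - k s‖ₑ := (hm.sub hk.measurable).enorm
  calc (∫⁻ x, ‖radialPotential R h x - radialPotential R k x‖ₑ ^ q
          ∂(leb (openBall N R))) ^ (1 / q)
      ≤ (∫⁻ x, (∫⁻ s in Ioo ‖x‖ R, ‖h s - k s‖ₑ) ^ q ∂(leb (openBall N R))) ^ (1 / q) := by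
        gcongr ?_ ^ (1 / q)
        refine lintegral_mono_ae ?_
        filter_upwards [hfin, ae_mem_openBall R] with x hx hxR
        gcongr
        exact enorm_radialPotential_sub_le hm hk hxR.le hx
    _ ≤ (ENNReal.ofReal R ^ q * ∫⁻ x, ‖h ‖x‖ - k ‖x‖‖ₑ ^ q ∂(leb (openBall N R))) ^ (1 / q) := by
        gcongr ?_ ^ (1 / q)
        exact lintegral_lintegral_Ioo_norm_rpow_le hN R hm' hq
    _ = _ := by
        rw [ENNReal.mul_rpow_of_nonneg _ _ (by positivity), ← ENNReal.rpow_mul,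
          mul_one_div_cancel hq0.ne', ENNReal.rpow_one]

/-- Guarantees that the integral defining the potential converges for almost every `x`, and is not
the default value zero of a divergent integral. By the Hardy-type identity, integrability of `|x|
h(|x|)` suffices. -/
theorem ae_lintegral_Ioo_norm_lt_top (hN : N ≠ 0) {R : ℝ} {h : ℝ → ℝ} (hm : Measurable h)
    (hh : ∫⁻ x : RN N, ‖(‖x‖ * h ‖x‖)‖ₑ ∂(leb (openBall N R)) < ∞) :
    ∀ᵐ x ∂(leb (openBall N R)), ∫⁻ s in Ioo ‖x‖ R, ‖h s‖ₑ < ∞ := by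
  have hS : MeasurableSet {z : RN N × ℝ | ‖z.1‖ < z.2 ∧ z.2 < R} :=
    (measurableSet_lt (measurable_norm.comp measurable_fst) measurable_snd).inter
      (measurableSet_lt measurable_snd measurable_const)
  have h1 : Measurable ({z : RN N × ℝ | ‖z.1‖ < z.2 ∧ z.2 < R}.indicator
      fun z => ‖h z.2‖ₑ) := (hm.enorm.comp measurable_snd).indicator hS
  have h2 : Measurable fun x : RN N => ∫⁻ s in Ioo ‖x‖ R, ‖h s‖ₑ := by
    convert h1.lintegral_prod_right' (ν := (volume : Measure ℝ)) using 2 with x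
    rw [← lintegral_indicator measurableSet_Ioo]
    congr 1
  refine ae_lt_top h2 ?_
  rw [lintegral_lintegral_Ioo_norm hN R hm.enorm]
  refine ENNReal.mul_ne_top (by simpa using hN) (ne_of_lt ?_)
  convert hh using 3 with x
  rw [enorm_mul, Real.enorm_eq_ofReal (norm_nonneg x)]

theorem exists_tendsto_radial (hN : N ≠ 0) {R : ℝ} (hR : 0 < R) {q : ℝ≥0∞}
    (hq : 1 ≤ q) (hq' : q ≠ ∞) {h : ℝ → ℝ} (hm : Measurable h)
    (hh : MemLp (fun x : RN N => h ‖x‖) q (leb (openBall N R))) :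
    ∃ k : ℕ → ℝ → ℝ, (∀ n, ContDiff ℝ (⊤ : ℕ∞) (k n)) ∧ (∀ n, tsupport (k n) ⊆ Ioo 0 R) ∧
      Tendsto (fun n => eLpNorm (fun x : RN N => h ‖x‖ - k n ‖x‖) q (leb (openBall N R)))
        atTop (𝓝 0) := by
  choose k h1 h2 h3 using fun n : ℕ => exists_radial_contDiff_eLpNorm_sub_le hN hR hq hq' hm hh
    (ε := 1 / ((n : ℝ) + 1)) (by positivity)
  refine ⟨k, h1, h2, ?_⟩
  have := (ENNReal.tendsto_ofReal tendsto_one_div_add_atTop_nhds_zero_nat)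
  rw [ENNReal.ofReal_zero] at this
  exact tendsto_of_tendsto_of_tendsto_of_le_of_le tendsto_const_nhds this (fun _ => zero_le) h3

theorem norm_div_norm_smul_le (c : ℝ) (x : RN N) : ‖(c / ‖x‖) • x‖ ≤ |c| := by
  rw [norm_smul, norm_div, norm_norm, Real.norm_eq_abs]
  rcases eq_or_ne ‖x‖ 0 with h | h
  · simp [h]
  · rw [div_mul_cancel₀ _ h]

theorem tendsto_lintegral_enorm_of_tendsto_eLpNorm {α E : Type*} [MeasurableSpace α]
    [NormedAddCommGroup E] {μ : Measure α} [IsFiniteMeasure μ] {F : ℕ → α → E} {q : ℝ≥0∞}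
    (hq : 1 ≤ q) (hF : ∀ n, AEStronglyMeasurable (F n) μ)
    (h : Tendsto (fun n => eLpNorm (F n) q μ) atTop (𝓝 0)) :
    Tendsto (fun n => ∫⁻ x, ‖F n x‖ₑ ∂μ) atTop (𝓝 0) := by
  have hc : μ univ ^ (1 / (1 : ℝ≥0∞).toReal - 1 / q.toReal) ≠ ∞ := by
    refine (ENNReal.rpow_lt_top_of_nonneg ?_ (measure_ne_top _ _)).ne
    rcases eq_or_ne q ∞ with rfl | hq'
    · simp
    · have : 1 ≤ q.toReal := by
        rw [← ENNReal.toReal_one]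
        exact ENNReal.toReal_mono hq' hq
      rw [ENNReal.toReal_one, div_one, sub_nonneg]
      exact div_le_one_of_le₀ this (by linarith)
  have h2 := ENNReal.Tendsto.mul_const h (Or.inr hc)
  rw [zero_mul] at h2
  refine tendsto_of_tendsto_of_tendsto_of_le_of_le tendsto_const_nhds h2 (fun _ => zero_le) ?_
  intro n
  dsimp only
  rw [← eLpNorm_one_eq_lintegral_enorm]
  exact eLpNorm_le_eLpNorm_mul_rpow_measure_univ hq (hF n)

/-- If `h(|x|)` is in `L^q(B_R)`, then `∫_{|x|}^R h(s) ds` is a limit of test functions in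
`W^{1,q}(B_R)`. -/
theorem radialPotential_memW1Zero (hN : N ≠ 0) {R : ℝ} (hR : 0 < R) {q : ℝ} (hq : 1 ≤ q)
    {h : ℝ → ℝ} (hm : Measurable h)
    (hh : MemLp (fun x : RN N => h ‖x‖) (ENNReal.ofReal q) (leb (openBall N R))) :
    MemLp (radialPotential R h : RN N → ℝ) (ENNReal.ofReal q) (leb (openBall N R)) ∧
    IsWeakGradient (openBall N R) (radialPotential R h) (fun x => (-h ‖x‖ / ‖x‖) • x) ∧
    MemLp (fun x : RN N => (-h ‖x‖ / ‖x‖) • x) (ENNReal.ofReal q) (leb (openBall N R)) ∧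
    ∃ φ : ℕ → TestFunction (openBall N R) ℝ ⊤,
      Tendsto (fun n => eLpNorm (fun x => radialPotential R h x - φ n x) (ENNReal.ofReal q)
        (leb (openBall N R))) atTop (𝓝 0) ∧
      Tendsto (fun n => eLpNorm (fun x => (-h ‖x‖ / ‖x‖) • x - gradient (φ n) x)
        (ENNReal.ofReal q) (leb (openBall N R))) atTop (𝓝 0) := by
  have hq1 : 1 ≤ ENNReal.ofReal q := by simpa using hq
  have hGm : Measurable fun x : RN N => (-h ‖x‖ / ‖x‖) • x :=
    (((hm.comp measurable_norm).neg).div measurable_norm).smul measurable_id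
  have hG : MemLp (fun x : RN N => (-h ‖x‖ / ‖x‖) • x) (ENNReal.ofReal q) (leb (openBall N R)) :=
    hh.mono hGm.aestronglyMeasurable (.of_forall fun x => by
      simpa using norm_div_norm_smul_le (-h ‖x‖) x)
  have hfin : ∀ᵐ x ∂(leb (openBall N R)), ∫⁻ s in Ioo ‖x‖ R, ‖h s‖ₑ < ∞ := by
    refine ae_lintegral_Ioo_norm_lt_top hN hm ?_
    refine lt_of_le_of_lt (b := ∫⁻ x : RN N, ENNReal.ofReal R * ‖h ‖x‖‖ₑ ∂(leb (openBall N R))) ?_ ?_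
    · refine lintegral_mono_ae ?_
      filter_upwards [ae_mem_openBall R] with x hx
      rw [enorm_mul, Real.enorm_eq_ofReal (norm_nonneg x)]
      gcongr
    · rw [lintegral_const_mul' _ _ ENNReal.ofReal_ne_top]
      exact ENNReal.mul_lt_top ENNReal.ofReal_lt_top (hh.integrable hq1).2
  have hum := aestronglyMeasurable_radialPotential (N := N) (R := R) hm
  have hu : MemLp (radialPotential R h : RN N → ℝ) (ENNReal.ofReal q) (leb (openBall N R)) := by
    refine ⟨hum, ?_⟩
    have := eLpNorm_radialPotential_sub_le hN hq hm continuous_const hfin (k := fun _ => 0)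
    simp only [radialPotential, intervalIntegral.integral_zero, sub_zero] at this
    exact this.trans_lt (ENNReal.mul_lt_top ENNReal.ofReal_lt_top hh.2)
  obtain ⟨k, hk, hks, hlim⟩ := exists_tendsto_radial hN hR hq1 ENNReal.ofReal_ne_top hm hh
  let φ : ℕ → TestFunction (openBall N R) ℝ ⊤ := fun n => radialTestFunction (hk n) (hks n)
  have t1 : Tendsto (fun n => eLpNorm (fun x => radialPotential R h x - φ n x) (ENNReal.ofReal q)
      (leb (openBall N R))) atTop (𝓝 0) := by
    have h2 := ENNReal.Tendsto.const_mul hlim (Or.inr (ENNReal.ofReal_ne_top (r := R)))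
    rw [mul_zero] at h2
    exact tendsto_of_tendsto_of_tendsto_of_le_of_le tendsto_const_nhds h2 (fun _ => zero_le)
      fun n => eLpNorm_radialPotential_sub_le hN hq hm (hk n).continuous hfin
  have t2 : Tendsto (fun n => eLpNorm (fun x => (-h ‖x‖ / ‖x‖) • x - gradient (φ n) x)
      (ENNReal.ofReal q) (leb (openBall N R))) atTop (𝓝 0) := by
    refine tendsto_of_tendsto_of_tendsto_of_le_of_le tendsto_const_nhds hlim (fun _ => zero_le)
      fun n => eLpNorm_mono fun x => ?_
    rw [gradient_radialTestFunction, ← sub_smul, ← sub_div]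
    refine (norm_div_norm_smul_le _ x).trans_eq ?_
    rw [Real.norm_eq_abs, ← abs_neg]
    congr 1
    ring
  refine ⟨hu, ?_, hG, φ, t1, t2⟩
  have hφi : ∀ n, Integrable (φ n) (leb (openBall N R)) := fun n =>
    ((φ n).continuous.integrable_of_hasCompactSupport (φ n).hasCompactSupport).restrict
  have hgi : ∀ n, Integrable (gradient (φ n)) (leb (openBall N R)) := fun n =>
    ((φ n).continuous_gradient.integrable_of_hasCompactSupport
      (φ n).hasCompactSupport_gradient).restrict
  exact IsWeakGradient.of_tendsto (hu.integrable hq1) (hG.integrable hq1) hφi hgi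
    (fun n => IsWeakGradient.of_contDiff (φ n).contDiff_one)
    (tendsto_lintegral_enorm_of_tendsto_eLpNorm hq1 (fun n => hum.sub (hφi n).1) t1)
    (tendsto_lintegral_enorm_of_tendsto_eLpNorm hq1
      (fun n => hGm.aestronglyMeasurable.sub (hgi n).1) t2)

end RadialPotential

/-! ### Weak derivatives of radial vector fields -/

section RadialField

variable {N : ℕ}

theorem hasGradientAt_coord (i : Fin N) (x : RN N) :
    HasGradientAt (fun y : RN N => y i) (EuclideanSpace.single i 1) x := by
  rw [hasGradientAt_iff_hasFDerivAt]
  refine ((EuclideanSpace.proj i : RN N →L[ℝ] ℝ).hasFDerivAt (x := x)).congr_fderiv ?_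
  ext v
  simp [EuclideanSpace.inner_single_left]

theorem hasGradientAt_coord_mul {g : RN N → ℝ} {v x : RN N} (hg : HasGradientAt g v x)
    (i : Fin N) : HasGradientAt (fun y : RN N => y i * g y)
      (g x • EuclideanSpace.single i 1 + x i • v) x := by
  have h := (hasGradientAt_iff_hasFDerivAt.1 (hasGradientAt_coord i x)).mul
    (hasGradientAt_iff_hasFDerivAt.1 hg)
  rw [hasGradientAt_iff_hasFDerivAt]
  refine h.congr_fderiv ?_
  simp only [map_add, map_smul]
  rw [add_comm]

theorem lintegral_radialPotential_sub_le (hN : N ≠ 0) {R : ℝ} {k l : ℝ → ℝ} (hm : Measurable k)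
    (hl : Continuous l) (hk : ∫⁻ x : RN N, ‖(‖x‖ * k ‖x‖)‖ₑ ∂(leb (openBall N R)) < ∞) :
    ∫⁻ x : RN N, ‖radialPotential R k x - radialPotential R l x‖ₑ ∂(leb (openBall N R)) ≤
      ∫⁻ x : RN N, ‖(‖x‖ * k ‖x‖ - ‖x‖ * l ‖x‖)‖ₑ ∂(leb (openBall N R)) := by
  calc _ ≤ ∫⁻ x, (∫⁻ s in Ioo ‖x‖ R, ‖k s - l s‖ₑ) ∂(leb (openBall N R)) := by
        refine lintegral_mono_ae ?_
        filter_upwards [ae_lintegral_Ioo_norm_lt_top hN hm hk, ae_mem_openBall R] with x hx hxR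
        exact enorm_radialPotential_sub_le hm hl hxR.le hx
    _ = (N : ℝ≥0∞)⁻¹ *
          ∫⁻ x, ENNReal.ofReal ‖x‖ * ‖k ‖x‖ - l ‖x‖‖ₑ ∂(leb (openBall N R)) :=
        lintegral_lintegral_Ioo_norm hN R (hm.sub hl.measurable).enorm
    _ ≤ 1 * ∫⁻ x, ENNReal.ofReal ‖x‖ * ‖k ‖x‖ - l ‖x‖‖ₑ ∂(leb (openBall N R)) := by
        gcongr
        rw [ENNReal.inv_le_one]
        exact_mod_cast Nat.pos_of_ne_zero hN
    _ = _ := by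
        rw [one_mul]
        congr 1 with x
        rw [← mul_sub, enorm_mul, Real.enorm_eq_ofReal (norm_nonneg x)]

/-- The approximation is made for `|x| k(|x|)`, since `k(|x|)` itself need not be integrable; the
weighted `L¹` norm is the one that controls both the potential and the derivative of the field. -/
theorem exists_tendsto_norm_mul_radial (hN : N ≠ 0) {R : ℝ} (hR : 0 < R) {k : ℝ → ℝ}
    (hm : Measurable k)
    (hk : ∫⁻ x : RN N, ‖(‖x‖ * k ‖x‖)‖ₑ ∂(leb (openBall N R)) < ∞) :
    ∃ l : ℕ → ℝ → ℝ, (∀ n, ContDiff ℝ (⊤ : ℕ∞) (l n)) ∧ (∀ n, tsupport (l n) ⊆ Ioo 0 R) ∧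
      Tendsto (fun n => ∫⁻ x : RN N, ‖(‖x‖ * k ‖x‖ - ‖x‖ * l n ‖x‖)‖ₑ ∂(leb (openBall N R)))
        atTop (𝓝 0) := by
  have hm' : Measurable fun s => s * k s := measurable_id.mul hm
  have hL : MemLp (fun x : RN N => ‖x‖ * k ‖x‖) 1 (leb (openBall N R)) :=
    memLp_one_iff_integrable.2 ⟨(hm'.comp measurable_norm).aestronglyMeasurable, hk⟩
  obtain ⟨m, h1, h2, h3⟩ := exists_tendsto_radial hN hR le_rfl ENNReal.one_ne_top hm' hL
  -- Each `m n` vanishes near zero, so dividing by `s` preserves smoothness and support.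
  refine ⟨fun n s => m n s / s, fun n => ?_, fun n => ?_, ?_⟩
  · rw [contDiff_iff_contDiffAt]
    intro s
    by_cases hs : s = 0
    · subst hs
      have h0 : (0 : ℝ) ∉ tsupport (m n) := fun h => lt_irrefl _ (h2 n h).1
      rw [notMem_tsupport_iff_eventuallyEq] at h0
      refine (contDiffAt_const (c := (0 : ℝ))).congr_of_eventuallyEq ?_
      filter_upwards [h0] with t ht
      rw [ht]
      simp
    · exact (h1 n).contDiffAt.div contDiffAt_id hs
  · refine (closure_mono fun s hs => ?_).trans (h2 n)
    rw [Function.mem_support] at hs ⊢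
    exact fun h => hs (by simp [h])
  · refine h3.congr fun n => ?_
    rw [eLpNorm_one_eq_lintegral_enorm]
    refine lintegral_congr_ae ?_
    filter_upwards [ae_norm_mem_Ioo hN R] with x hx
    rw [mul_div_cancel₀ _ hx.1.ne']

/-- Weak differentiability of the components of a radial vector field `W(|x|) x`. -/
theorem isWeakGradient_coord_mul_radial (hN : N ≠ 0) {R : ℝ} (hR : 0 < R) {k W : ℝ → ℝ} {c : ℝ}
    (hm : Measurable k)
    (hk : ∫⁻ x : RN N, ‖(‖x‖ * k ‖x‖)‖ₑ ∂(leb (openBall N R)) < ∞)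
    (hW : ∀ ρ ∈ Ioo 0 R, W ρ = c - ∫ s in ρ..R, k s) (i : Fin N) :
    IsWeakGradient (openBall N R) (fun x => x i * W ‖x‖)
      (fun x => W ‖x‖ • EuclideanSpace.single i 1 + x i • (k ‖x‖ / ‖x‖) • x) := by
  have hWae : ∀ᵐ x ∂(leb (openBall N R)), c - radialPotential R k x = W ‖x‖ := by
    filter_upwards [ae_norm_mem_Ioo hN R] with x hx
    rw [hW _ hx, radialPotential]
  suffices h : IsWeakGradient (openBall N R) (fun x => x i * (c - radialPotential R k x))
      (fun x => (c - radialPotential R k x) • EuclideanSpace.single i 1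
        + x i • (k ‖x‖ / ‖x‖) • x) by
    refine h.congr_ae ?_ ?_ <;>
    · filter_upwards [hWae] with x hx
      rw [hx]
  have hxi : ∀ x : RN N, |x i| ≤ ‖x‖ := fun x => PiLp.norm_apply_le x i
  have hpm := aestronglyMeasurable_radialPotential (N := N) (R := R) hm
  have hkm : AEStronglyMeasurable (fun x : RN N => ‖x‖ * k ‖x‖) (leb (openBall N R)) :=
    (measurable_norm.mul (hm.comp measurable_norm)).aestronglyMeasurable
  have hki : Integrable (fun x : RN N => ‖x‖ * k ‖x‖) (leb (openBall N R)) := ⟨hkm, hk⟩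
  have hpi : Integrable (radialPotential R k : RN N → ℝ) (leb (openBall N R)) := by
    refine ⟨hpm, ?_⟩
    have := lintegral_radialPotential_sub_le hN hm continuous_const (l := fun _ => 0) hk
    simp only [radialPotential, intervalIntegral.integral_zero, sub_zero, mul_zero] at this
    exact this.trans_lt hk
  have hxm : Measurable fun x : RN N => x i :=
    (EuclideanSpace.proj i : RN N →L[ℝ] ℝ).continuous.measurable
  have hcp : Integrable (fun x : RN N => c - radialPotential R k x) (leb (openBall N R)) :=
    (integrable_const c).sub hpi
  have hfield : ∀ (a b : ℝ) (x : RN N), ‖a • (EuclideanSpace.single i 1 : RN N) +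
      x i • (b / ‖x‖) • x‖ ≤ |a| + |‖x‖ * b| := by
    intro a b x
    refine (norm_add_le _ _).trans (add_le_add ?_ ?_)
    · simp [norm_smul]
    · rw [norm_smul, abs_mul, abs_norm]
      exact mul_le_mul (hxi x) (norm_div_norm_smul_le b x) (norm_nonneg _) (norm_nonneg _)
  have hu : Integrable (fun x : RN N => x i * (c - radialPotential R k x))
      (leb (openBall N R)) := by
    refine (hcp.norm.const_mul R).mono (hxm.aestronglyMeasurable.mul hcp.1) ?_
    filter_upwards [ae_mem_openBall R] with x hx
    rw [norm_mul, norm_mul, norm_norm, Real.norm_eq_abs, Real.norm_eq_abs R, abs_of_pos hR]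
    gcongr
    exact (hxi x).trans hx.le
  have hGm : AEStronglyMeasurable (fun x : RN N => (c - radialPotential R k x) •
      (EuclideanSpace.single i 1 : RN N) + x i • (k ‖x‖ / ‖x‖) • x) (leb (openBall N R)) := by
    refine (hcp.1.smul_const _).add (Measurable.aestronglyMeasurable ?_)
    exact hxm.smul (((hm.comp measurable_norm).div measurable_norm).smul measurable_id)
  have hG : Integrable (fun x : RN N => (c - radialPotential R k x) •
      (EuclideanSpace.single i 1 : RN N) + x i • (k ‖x‖ / ‖x‖) • x) (leb (openBall N R)) :=
    (hcp.norm.add hki.norm).mono hGm (.of_forall fun x => by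
      exact (hfield _ _ x).trans (le_abs_self _))
  obtain ⟨l, hl, hls, hlim⟩ := exists_tendsto_norm_mul_radial hN hR hm hk
  have hlim' : Tendsto (fun n => ∫⁻ x : RN N, ‖radialPotential R k x - radialPotential R (l n) x‖ₑ
      ∂(leb (openBall N R))) atTop (𝓝 0) :=
    tendsto_of_tendsto_of_tendsto_of_le_of_le tendsto_const_nhds hlim (fun _ => zero_le)
      fun n => lintegral_radialPotential_sub_le hN hm (hl n).continuous hk
  -- These approximants are `C¹` on the whole space, so their weak gradients are classical; it
  -- remains to pass to the limit in `L¹`.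
  let v : ℕ → RN N → ℝ := fun n x => x i * (c - radialPotential R (l n) x)
  have hvd : ∀ n, ContDiff ℝ 1 (v n) := fun n =>
    ContDiff.mul (EuclideanSpace.proj i : RN N →L[ℝ] ℝ).contDiff
      (contDiff_const.sub ((contDiff_radialPotential (hl n) (hls n)).of_le
        (by exact_mod_cast le_top)))
  have hvg : ∀ n x, gradient (v n) x = (c - radialPotential R (l n) x) •
      (EuclideanSpace.single i 1 : RN N) + x i • (l n ‖x‖ / ‖x‖) • x := by
    intro n x
    refine (hasGradientAt_coord_mul (g := fun x => c - radialPotential R (l n) x) ?_ i).gradient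
    have h := (hasGradientAt_radialPotential (hl n).continuous (hls n) x)
    rw [hasGradientAt_iff_hasFDerivAt] at h ⊢
    refine (h.const_sub c).congr_fderiv ?_
    rw [neg_div, neg_smul, map_neg, neg_neg]
  have hint : ∀ {E : Type} [NormedAddCommGroup E] (f : RN N → E), Continuous f →
      Integrable f (leb (openBall N R)) := fun f hf =>
    (hf.continuousOn.integrableOn_compact (isCompact_closedBall (0 : RN N) R)).mono_set
      Metric.ball_subset_closedBall
  refine IsWeakGradient.of_tendsto hu hG (fun n => hint _ (hvd n).continuous)
    (fun n => hint _ (continuous_gradient (hvd n))) (fun n => IsWeakGradient.of_contDiff (hvd n))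
    ?_ ?_
  · have h2 := ENNReal.Tendsto.const_mul hlim' (Or.inr (ENNReal.ofReal_ne_top (r := R)))
    rw [mul_zero] at h2
    refine tendsto_of_tendsto_of_tendsto_of_le_of_le tendsto_const_nhds h2 (fun _ => zero_le) ?_
    intro n
    dsimp only
    rw [← lintegral_const_mul' _ _ ENNReal.ofReal_ne_top]
    refine lintegral_mono_ae ?_
    filter_upwards [ae_mem_openBall R] with x hx
    rw [← mul_sub, sub_sub_sub_cancel_left, enorm_mul, enorm_sub_rev]
    gcongr
    rw [Real.enorm_eq_ofReal_abs]
    exact ENNReal.ofReal_le_ofReal ((hxi x).trans hx.le)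
  · have h2 := hlim'.add hlim
    rw [add_zero] at h2
    refine tendsto_of_tendsto_of_tendsto_of_le_of_le tendsto_const_nhds h2 (fun _ => zero_le) ?_
    intro n
    dsimp only
    have hdm : AEMeasurable (fun x : RN N => ‖radialPotential R k x - radialPotential R (l n) x‖ₑ)
        (leb (openBall N R)) :=
      (hpm.sub (hint _ (contDiff_radialPotential (hl n) (hls n)).continuous).1).enorm
    rw [← lintegral_add_left' hdm]
    refine lintegral_mono fun x => ?_
    have e : (c - radialPotential R k x) • (EuclideanSpace.single i 1 : RN N)
        + x i • (k ‖x‖ / ‖x‖) • x - gradient (v n) x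
        = (radialPotential R (l n) x - radialPotential R k x) • (EuclideanSpace.single i 1 : RN N)
        + x i • ((k ‖x‖ - l n ‖x‖) / ‖x‖) • x := by
      rw [hvg, sub_div]
      module
    dsimp only
    rw [e, ← ofReal_norm, ← ofReal_norm, ← ofReal_norm,
      ← ENNReal.ofReal_add (norm_nonneg _) (norm_nonneg _)]
    refine ENNReal.ofReal_le_ofReal ((hfield _ _ x).trans_eq ?_)
    rw [abs_sub_comm, mul_sub]
    rfl

end RadialField

/-! ### Radial profiles and the explicit flux -/

section Profile

/-- A non-negative profile, non-increasing on `(0, ∞)` and bounded by `C s^{-b}`. -/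
structure IsRadialProfile (b C : ℝ) (g : ℝ → ℝ) : Prop where
  measurable : Measurable g
  antitoneOn : AntitoneOn g (Ioi 0)
  nonneg : ∀ s, 0 ≤ g s
  eq_zero : ∀ s ≤ 0, g s = 0
  le_rpow : ∀ s, 0 < s → g s ≤ C * s ^ (-b)

/-- The mass `∫₀^ρ s^{N-1} g(s) ds`. -/
noncomputable def radialMass (N : ℕ) (g : ℝ → ℝ) (ρ : ℝ) : ℝ := ∫ s in (0 : ℝ)..ρ, s ^ (N - 1) * g s

/-- The factor `W` for which `W(|x|) x` is the field `-(|x|^{1-N} M(|x|))^θ x/|x|`, with `M` the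
mass of `g`. -/
noncomputable def fluxFactor (N : ℕ) (g : ℝ → ℝ) (θ ρ : ℝ) : ℝ :=
  -(ρ ^ (-1 - θ * ((N : ℝ) - 1)) * radialMass N g ρ ^ θ)

/-- The derivative of `fluxFactor`. -/
noncomputable def fluxFactorDeriv (N : ℕ) (g : ℝ → ℝ) (θ ρ : ℝ) : ℝ :=
  -((-1 - θ * ((N : ℝ) - 1)) * ρ ^ (-1 - θ * ((N : ℝ) - 1) - 1) * radialMass N g ρ ^ θ +
    ρ ^ (-1 - θ * ((N : ℝ) - 1)) *
      (ρ ^ (N - 1) * g ρ * θ * radialMass N g ρ ^ (θ - 1)))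

variable {N : ℕ} {b C : ℝ} {g : ℝ → ℝ}

/-- Logarithmic differentiation of a power of `ρ` times `M^θ`. The data enter only through the ratio
`ρ^N g(ρ) / M(ρ)`, which is bounded for decreasing profiles and constant for powers. -/
theorem mul_fluxFactorDeriv (hN : N ≠ 0) (θ : ℝ) {ρ : ℝ} (hρ : 0 < ρ)
    (hM : 0 < radialMass N g ρ) : ρ * fluxFactorDeriv N g θ ρ =
      (-1 - θ * ((N : ℝ) - 1) + θ * (ρ ^ N * g ρ / radialMass N g ρ)) * fluxFactor N g θ ρ := by
  set M := radialMass N g ρ with hMdef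
  set e := -1 - θ * ((N : ℝ) - 1) with he
  have e1 : ρ * ρ ^ (e - 1) = ρ ^ e := by
    rw [Real.rpow_sub_one hρ.ne']
    field_simp
  have e2 : M ^ (θ - 1) = M ^ θ / M := Real.rpow_sub_one hM.ne' θ
  have e3 : ρ * ρ ^ (N - 1) = ρ ^ N := mul_pow_sub_one hN ρ
  rw [fluxFactorDeriv, fluxFactor, ← hMdef, ← he, e2, ← e3]
  calc _ = -(e * (ρ * ρ ^ (e - 1)) * M ^ θ +
        ρ * (ρ ^ e * (ρ ^ (N - 1) * g ρ * θ * (M ^ θ / M)))) := by ring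
    _ = _ := by rw [e1]; ring

namespace IsRadialProfile

theorem const_nonneg (hg : IsRadialProfile b C g) : 0 ≤ C := by
  simpa using (hg.nonneg 1).trans (hg.le_rpow 1 one_pos)

theorem pow_mul_le (hg : IsRadialProfile b C g) (hN : N ≠ 0) {s : ℝ} (hs : 0 < s) :
    s ^ (N - 1) * g s ≤ C * s ^ ((N : ℝ) - b - 1) := by
  calc s ^ (N - 1) * g s ≤ s ^ (N - 1) * (C * s ^ (-b)) := by
        gcongr
        exact hg.le_rpow s hs
    _ = C * (s ^ (((N - 1 : ℕ) : ℝ)) * s ^ (-b)) := by rw [Real.rpow_natCast]; ring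
    _ = _ := by
        rw [← Real.rpow_add hs, Nat.cast_sub (Nat.one_le_iff_ne_zero.2 hN)]
        congr 2
        push_cast
        ring

theorem intervalIntegrable (hg : IsRadialProfile b C g) (hN : N ≠ 0) (hb : b < N) (u v : ℝ) :
    IntervalIntegrable (fun s => s ^ (N - 1) * g s) volume u v := by
  have hm : Measurable fun s => s ^ (N - 1) * g s := (measurable_id.pow_const _).mul hg.measurable
  have key : ∀ ρ : ℝ, IntervalIntegrable (fun s => s ^ (N - 1) * g s) volume 0 ρ := by
    intro ρ
    -- For negative endpoints the profile is zero by convention.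
    rcases le_or_gt ρ 0 with h | h
    · refine (intervalIntegrable_iff.2 ?_)
      rw [uIoc_of_ge h]
      refine integrableOn_zero.congr_fun (fun s hs => ?_) measurableSet_Ioc
      simp [hg.eq_zero s hs.2]
    · have h1 : IntervalIntegrable (fun s : ℝ => C * s ^ ((N : ℝ) - b - 1)) volume 0 ρ :=
        (intervalIntegral.intervalIntegrable_rpow' (by linarith)).const_mul C
      refine h1.mono_fun hm.aestronglyMeasurable ?_
      rw [uIoc_of_le h.le]
      filter_upwards [ae_restrict_mem measurableSet_Ioc] with s hs
      rw [Real.norm_of_nonneg (mul_nonneg (pow_nonneg hs.1.le _) (hg.nonneg s))]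
      exact (hg.pow_mul_le hN hs.1).trans (le_abs_self _)
  exact (key u).symm.trans (key v)

theorem continuous_radialMass (hg : IsRadialProfile b C g) (hN : N ≠ 0) (hb : b < N) :
    Continuous (radialMass N g) :=
  intervalIntegral.continuous_primitive (fun u v => hg.intervalIntegrable hN hb u v) 0

theorem radialMass_le (hg : IsRadialProfile b C g) (hN : N ≠ 0) (hb : b < N) {ρ : ℝ}
    (hρ : 0 < ρ) : radialMass N g ρ ≤ C / (N - b) * ρ ^ ((N : ℝ) - b) := by
  calc radialMass N g ρ ≤ ∫ s in (0 : ℝ)..ρ, C * s ^ ((N : ℝ) - b - 1) := by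
        refine intervalIntegral.integral_mono_on_of_le_Ioo hρ.le (hg.intervalIntegrable hN hb _ _)
          ((intervalIntegral.intervalIntegrable_rpow' (by linarith)).const_mul C) fun s hs => ?_
        exact hg.pow_mul_le hN hs.1
    _ = _ := by
        have hne : (N : ℝ) - b ≠ 0 := by linarith
        rw [intervalIntegral.integral_const_mul, integral_rpow (Or.inl (by linarith)),
          sub_add_cancel, Real.zero_rpow hne]
        ring

theorem radialMass_nonneg (hg : IsRadialProfile b C g) {ρ : ℝ} (hρ : 0 ≤ ρ) :
    0 ≤ radialMass N g ρ :=
  intervalIntegral.integral_nonneg hρ fun s hs => mul_nonneg (pow_nonneg hs.1 _) (hg.nonneg s)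

/-- Replace `g(s)` by the smaller value `g(ρ)` in the mass and integrate `s^{N-1}`. This is where
radial monotonicity of the data gives a differentiability gain: it bounds `M'` by `N M/ρ`. -/
theorem pow_mul_le_radialMass (hg : IsRadialProfile b C g) (hN : N ≠ 0) (hb : b < N) {ρ : ℝ}
    (hρ : 0 < ρ) : ρ ^ N * g ρ ≤ N * radialMass N g ρ := by
  have h : ∫ s in (0 : ℝ)..ρ, s ^ (N - 1) * g ρ ≤ radialMass N g ρ := by
    refine intervalIntegral.integral_mono_on_of_le_Ioo hρ.le
      (Continuous.intervalIntegrable (by fun_prop) _ _) (hg.intervalIntegrable hN hb _ _)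
      fun s hs => ?_
    exact mul_le_mul_of_nonneg_left (hg.antitoneOn hs.1 hρ hs.2.le) (pow_nonneg hs.1.le _)
  rw [intervalIntegral.integral_mul_const, integral_pow,
    Nat.sub_add_cancel (Nat.one_le_iff_ne_zero.2 hN), zero_pow hN, sub_zero,
    Nat.cast_sub (Nat.one_le_iff_ne_zero.2 hN), Nat.cast_one, sub_add_cancel] at h
  have hN' : (0 : ℝ) < N := by exact_mod_cast Nat.pos_of_ne_zero hN
  calc ρ ^ N * g ρ = N * (ρ ^ N / N * g ρ) := by field_simp
    _ ≤ _ := by gcongr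

theorem hasDerivAt_radialMass (hg : IsRadialProfile b C g) (hN : N ≠ 0) (hb : b < N) {ρ : ℝ}
    (hc : ContinuousAt g ρ) : HasDerivAt (radialMass N g) (ρ ^ (N - 1) * g ρ) ρ := by
  have hm : Measurable fun s => s ^ (N - 1) * g s := (measurable_id.pow_const _).mul hg.measurable
  exact intervalIntegral.integral_hasDerivAt_right (hg.intervalIntegrable hN hb _ _)
    hm.stronglyMeasurable.stronglyMeasurableAtFilter ((continuousAt_id.pow _).mul hc)

/-- A decreasing profile that is positive somewhere is positive all the way down to zero. The
dichotomy avoids differentiating `M^θ` at `M = 0`. -/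
theorem eq_zero_or_radialMass_pos (hg : IsRadialProfile b C g) (hN : N ≠ 0) (hb : b < N) :
    (∀ s, g s = 0) ∨ ∀ ρ, 0 < ρ → 0 < radialMass N g ρ := by
  by_cases h : ∃ s, g s ≠ 0
  · right
    obtain ⟨s, hs⟩ := h
    have hs0 : 0 < s := by
      by_contra! h
      exact hs (hg.eq_zero s h)
    have hgs : 0 < g s := lt_of_le_of_ne (hg.nonneg s) hs.symm
    intro ρ hρ
    have hm : 0 < min s ρ := lt_min hs0 hρ
    have h1 := hg.pow_mul_le_radialMass hN hb hm
    have h2 : 0 < g (min s ρ) := hgs.trans_le (hg.antitoneOn hm hs0 (min_le_left _ _))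
    have h3 : 0 < radialMass N g (min s ρ) := by
      have := (mul_pos (pow_pos hm N) h2).trans_le h1
      exact pos_of_mul_pos_right this (Nat.cast_nonneg _)
    have h4 : radialMass N g (min s ρ) ≤ radialMass N g ρ := by
      refine intervalIntegral.integral_mono_interval le_rfl hm.le (min_le_right _ _) ?_
        (hg.intervalIntegrable hN hb _ _)
      filter_upwards [ae_restrict_mem measurableSet_Ioc] with t ht
      exact mul_nonneg (pow_nonneg ht.1.le _) (hg.nonneg t)
    exact h3.trans_le h4
  · left
    push Not at h
    exact h

theorem countable_not_continuousAt (hg : IsRadialProfile b C g) :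
    {x ∈ Ioi (0 : ℝ) | ¬ContinuousAt g x}.Countable := by
  refine Set.Countable.mono ?_ hg.antitoneOn.countable_not_continuousWithinAt
  intro x hx
  refine ⟨hx.1, fun h => ?_⟩
  exact hx.2 (h.continuousAt (Ioi_mem_nhds hx.1))

theorem measurable_fluxFactor (hg : IsRadialProfile b C g) (hN : N ≠ 0) (hb : b < N) (θ : ℝ) :
    Measurable (fluxFactor N g θ) := by
  have := (hg.continuous_radialMass hN hb).measurable
  unfold fluxFactor
  fun_prop

theorem measurable_fluxFactorDeriv (hg : IsRadialProfile b C g) (hN : N ≠ 0) (hb : b < N)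
    (θ : ℝ) : Measurable (fluxFactorDeriv N g θ) := by
  have := (hg.continuous_radialMass hN hb).measurable
  have := hg.measurable
  unfold fluxFactorDeriv
  fun_prop

theorem abs_fluxFactor_le (hg : IsRadialProfile b C g) (hN : N ≠ 0) (hb : b < N) {θ : ℝ}
    (hθ : 0 < θ) {ρ : ℝ} (hρ : 0 < ρ) :
    |fluxFactor N g θ ρ| ≤ (C / (N - b)) ^ θ * ρ ^ (-1 + θ * (1 - b)) := by
  have hC : 0 ≤ C / (N - b) := div_nonneg hg.const_nonneg (by linarith)
  have h0 := hg.radialMass_nonneg (N := N) hρ.le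
  rw [fluxFactor, abs_neg, abs_of_nonneg (mul_nonneg (Real.rpow_nonneg hρ.le _)
    (Real.rpow_nonneg h0 _))]
  calc _ ≤ ρ ^ (-1 - θ * ((N : ℝ) - 1)) * (C / (N - b) * ρ ^ ((N : ℝ) - b)) ^ θ := by
        gcongr
        exact hg.radialMass_le hN hb hρ
    _ = (C / (N - b)) ^ θ * (ρ ^ (-1 - θ * ((N : ℝ) - 1)) * ρ ^ (((N : ℝ) - b) * θ)) := by
        rw [Real.mul_rpow hC (Real.rpow_nonneg hρ.le _), ← Real.rpow_mul hρ.le]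
        ring
    _ = _ := by
        rw [← Real.rpow_add hρ]
        congr 2
        ring

/-- The ratio `ρ^N g / M` lies in `[0, N]`, so the logarithmic derivative of the flux factor is
bounded. Integrability of the derivative of the field thereby reduces to that of `W` itself. -/
theorem abs_mul_fluxFactorDeriv_le (hg : IsRadialProfile b C g) (hN : N ≠ 0) (hb : b < N)
    {θ : ℝ} (hθ : 0 < θ) {ρ : ℝ} (hρ : 0 < ρ) :
    |ρ * fluxFactorDeriv N g θ ρ| ≤ (1 + 2 * θ * N) * |fluxFactor N g θ ρ| := by
  have hN1 : (1 : ℝ) ≤ N := by exact_mod_cast Nat.one_le_iff_ne_zero.2 hN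
  rcases hg.eq_zero_or_radialMass_pos hN hb with h | h
  · have : radialMass N g ρ = 0 := by simp [radialMass, h]
    simp [fluxFactorDeriv, fluxFactor, this, h, Real.zero_rpow hθ.ne']
  have hM := h ρ hρ
  have e4 := mul_fluxFactorDeriv (g := g) hN θ hρ hM
  set M := radialMass N g ρ with hMdef
  have hr0 : 0 ≤ ρ ^ N * g ρ / M := div_nonneg (mul_nonneg (pow_nonneg hρ.le _) (hg.nonneg ρ)) hM.le
  have hr1 : ρ ^ N * g ρ / M ≤ N := by
    rw [div_le_iff₀ hM]
    exact hg.pow_mul_le_radialMass hN hb hρ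
  rw [e4, abs_mul]
  gcongr
  have h5 : θ * (ρ ^ N * g ρ / M) ≤ θ * N := by gcongr
  have h6 : 0 ≤ θ * (ρ ^ N * g ρ / M) := by positivity
  have h7 : 0 ≤ θ * ((N : ℝ) - 1) := mul_nonneg hθ.le (by linarith)
  rw [abs_le]
  constructor <;> nlinarith

/-- `M` is known to be differentiable only where `g` is continuous, but a monotone function has
countably many discontinuities, which the fundamental theorem of calculus tolerates for a continuous
primitive. -/
theorem fluxFactor_eq_sub_integral (hg : IsRadialProfile b C g) (hN : N ≠ 0) (hb : b < N)
    {θ : ℝ} (hθ : 0 < θ) {ρ R : ℝ} (hρ : 0 < ρ) (hR : ρ ≤ R) :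
    fluxFactor N g θ ρ = fluxFactor N g θ R - ∫ s in ρ..R, fluxFactorDeriv N g θ s := by
  rcases hg.eq_zero_or_radialMass_pos hN hb with h | h
  · have hz : ∀ r, radialMass N g r = 0 := fun r => by simp [radialMass, h]
    simp [fluxFactorDeriv, fluxFactor, hz, h, Real.zero_rpow hθ.ne']
  have hpos : ∀ s ∈ Icc ρ R, 0 < s := fun s hs => hρ.trans_le hs.1
  have hd : ∀ s, 0 < s → ContinuousAt g s →
      HasDerivAt (fluxFactor N g θ) (fluxFactorDeriv N g θ s) s := by
    intro s hs hc
    have h1 := Real.hasDerivAt_rpow_const (x := s) (p := -1 - θ * ((N : ℝ) - 1)) (Or.inl hs.ne')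
    have h2 := (hg.hasDerivAt_radialMass hN hb hc).rpow_const (p := θ) (Or.inl (h s hs).ne')
    exact (h1.mul h2).neg
  have hcont : ContinuousOn (fluxFactor N g θ) (Icc ρ R) := by
    refine ContinuousOn.neg (ContinuousOn.mul ?_ ?_)
    · exact fun s hs => (Real.continuousAt_rpow_const s _
        (Or.inl (hpos s hs).ne')).continuousWithinAt
    · exact fun s hs => ((hg.continuous_radialMass hN hb).continuousAt.rpow_const
        (Or.inl (h s (hpos s hs)).ne')).continuousWithinAt
  have hint : IntervalIntegrable (fluxFactorDeriv N g θ) volume ρ R := by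
    -- The derivative contains `g` and may jump; it is dominated by this continuous function.
    have h1 : ContinuousOn (fun s => (1 + 2 * θ * N) * |fluxFactor N g θ s| / s) (Icc ρ R) :=
      (continuousOn_const.mul hcont.abs).div continuousOn_id fun s hs => (hpos s hs).ne'
    rw [← uIcc_of_le hR] at h1
    refine h1.intervalIntegrable.mono_fun
      (hg.measurable_fluxFactorDeriv hN hb θ).aestronglyMeasurable ?_
    rw [uIoc_of_le hR]
    filter_upwards [ae_restrict_mem measurableSet_Ioc] with s hs
    have hs0 : 0 < s := hρ.trans hs.1
    refine le_trans ?_ (le_abs_self _)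
    rw [le_div_iff₀ hs0, Real.norm_eq_abs]
    have := hg.abs_mul_fluxFactorDeriv_le hN hb hθ hs0
    rwa [abs_mul, abs_of_pos hs0, mul_comm] at this
  rw [integral_eq_of_hasDerivAt_off_countable_of_le (fluxFactor N g θ) _ hR
    hg.countable_not_continuousAt hcont (fun s hs => ?_) hint]
  · ring
  · have hs0 : 0 < s := hρ.trans hs.1.1
    refine hd s hs0 ?_
    by_contra hc
    exact hs.2 ⟨hs0, hc⟩

end IsRadialProfile

end Profile

/-! ### Monotonicity of the degenerate field and uniqueness -/

section Monotone

variable {N : ℕ}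

theorem fieldH_eq_smul (α : ℝ) (ξ : RN N) :
    fieldH α ξ = (max (‖ξ‖ - 1) 0 ^ α / ‖ξ‖) • ξ := by
  unfold fieldH
  split_ifs with h
  · simp [h]
  · rfl

theorem measurable_fieldH (α : ℝ) : Measurable (fieldH α : RN N → RN N) := by
  rw [show (fieldH α : RN N → RN N) = fun ξ => (max (‖ξ‖ - 1) 0 ^ α / ‖ξ‖) • ξ from
    funext (fieldH_eq_smul α)]
  fun_prop

theorem fieldH_eq_zero_of_norm_le_one {α : ℝ} (hα : 0 < α) {ξ : RN N} (h : ‖ξ‖ ≤ 1) :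
    fieldH α ξ = 0 := by
  rw [fieldH_eq_smul, max_eq_right (by linarith), Real.zero_rpow hα.ne', zero_div, zero_smul]

theorem norm_fieldH_le {α : ℝ} (hα : 0 ≤ α) (ξ : RN N) : ‖fieldH α ξ‖ ≤ ‖ξ‖ ^ α := by
  rw [fieldH_eq_smul]
  refine (norm_div_norm_smul_le _ ξ).trans ?_
  rw [abs_of_nonneg (by positivity)]
  gcongr
  exact max_le (by linarith) (norm_nonneg _)

theorem max_sub_one_rpow_lt {α : ℝ} (hα : 0 < α) {s t : ℝ} (hst : s < t) (ht : 1 < t) :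
    max (s - 1) 0 ^ α < max (t - 1) 0 ^ α := by
  refine Real.rpow_lt_rpow (le_max_right _ _) ?_ hα
  rw [max_eq_left (by linarith : (0 : ℝ) ≤ t - 1)]
  exact max_lt (by linarith) (by linarith)

/-- Splits the monotonicity expression into a radial term and an angular term. Both are
non-negative, so when the sum vanishes each can be exploited separately. -/
theorem inner_fieldH_sub (α : ℝ) (hα : 0 < α) (ξ η : RN N) :
    inner ℝ (fieldH α ξ - fieldH α η) (ξ - η) =
      (max (‖ξ‖ - 1) 0 ^ α - max (‖η‖ - 1) 0 ^ α) * (‖ξ‖ - ‖η‖) +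
      (max (‖ξ‖ - 1) 0 ^ α / ‖ξ‖ + max (‖η‖ - 1) 0 ^ α / ‖η‖) * (‖ξ‖ * ‖η‖ - inner ℝ ξ η) := by
  have h : ∀ ζ : RN N, max (‖ζ‖ - 1) 0 ^ α = max (‖ζ‖ - 1) 0 ^ α / ‖ζ‖ * ‖ζ‖ := by
    intro ζ
    rcases eq_or_ne ‖ζ‖ 0 with h | h
    · simp [h, hα.ne']
    · rw [div_mul_cancel₀ _ h]
  rw [fieldH_eq_smul, fieldH_eq_smul]
  set A := max (‖ξ‖ - 1) 0 ^ α / ‖ξ‖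
  set B := max (‖η‖ - 1) 0 ^ α / ‖η‖
  rw [h ξ, h η]
  simp only [inner_sub_left, inner_sub_right, real_inner_smul_left, real_inner_self_eq_norm_sq,
    real_inner_comm ξ η]
  ring

theorem mul_sub_nonneg_of_max_rpow {α : ℝ} (hα : 0 < α) (s t : ℝ) :
    0 ≤ (max (s - 1) 0 ^ α - max (t - 1) 0 ^ α) * (s - t) := by
  rcases le_total s t with h | h
  · refine mul_nonneg_of_nonpos_of_nonpos (sub_nonpos.2 ?_) (sub_nonpos.2 h)
    gcongr
  · refine mul_nonneg (sub_nonneg.2 ?_) (sub_nonneg.2 h)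
    gcongr

theorem inner_fieldH_sub_nonneg {α : ℝ} (hα : 0 < α) (ξ η : RN N) :
    0 ≤ inner ℝ (fieldH α ξ - fieldH α η) (ξ - η) := by
  rw [inner_fieldH_sub α hα]
  refine add_nonneg (mul_sub_nonneg_of_max_rpow hα _ _) (mul_nonneg (by positivity) ?_)
  exact sub_nonneg.2 (real_inner_le_norm _ _)

/-- Two gradients at which the field is not strictly monotone have the same image under all the
fields `H_β`. -/
theorem fieldH_eq_of_inner_sub_eq_zero {α : ℝ} (hα : 0 < α) {ξ η : RN N}
    (h : inner ℝ (fieldH α ξ - fieldH α η) (ξ - η) = 0) {β : ℝ} (hβ : 0 < β) :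
    fieldH β ξ = fieldH β η := by
  rw [inner_fieldH_sub α hα] at h
  have h1 := mul_sub_nonneg_of_max_rpow hα ‖ξ‖ ‖η‖
  have h2 : 0 ≤ ‖ξ‖ * ‖η‖ - inner ℝ ξ η := sub_nonneg.2 (real_inner_le_norm _ _)
  have h3 : 0 ≤ (max (‖ξ‖ - 1) 0 ^ α / ‖ξ‖ + max (‖η‖ - 1) 0 ^ α / ‖η‖) *
      (‖ξ‖ * ‖η‖ - inner ℝ ξ η) := mul_nonneg (by positivity) h2
  -- In the closed unit ball the vectors may differ but all fields vanish. Otherwise the radial term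
  -- forces equal norms, the angular term forces equality in Cauchy–Schwarz, and `ξ = η`.
  by_cases hle : ‖ξ‖ ≤ 1 ∧ ‖η‖ ≤ 1
  · rw [fieldH_eq_zero_of_norm_le_one hβ hle.1, fieldH_eq_zero_of_norm_le_one hβ hle.2]
  have hst : ‖ξ‖ = ‖η‖ := by
    by_contra hne
    have h4 : max (‖ξ‖ - 1) 0 ^ α - max (‖η‖ - 1) 0 ^ α = 0 := by
      have : (max (‖ξ‖ - 1) 0 ^ α - max (‖η‖ - 1) 0 ^ α) * (‖ξ‖ - ‖η‖) = 0 := by linarith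
      exact (mul_eq_zero.1 this).resolve_right (sub_ne_zero.2 hne)
    rcases lt_or_gt_of_ne hne with hlt | hlt
    · have : 1 < ‖η‖ := by
        by_contra! h'
        exact hle ⟨hlt.le.trans h', h'⟩
      linarith [max_sub_one_rpow_lt hα hlt this]
    · have : 1 < ‖ξ‖ := by
        by_contra! h'
        exact hle ⟨h', hlt.le.trans h'⟩
      linarith [max_sub_one_rpow_lt hα hlt this]
  have hgt : 1 < ‖ξ‖ := by
    by_contra! h'
    exact hle ⟨h', hst ▸ h'⟩
  have hA : 0 < max (‖ξ‖ - 1) 0 ^ α / ‖ξ‖ + max (‖η‖ - 1) 0 ^ α / ‖η‖ := by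
    refine add_pos_of_pos_of_nonneg (div_pos (Real.rpow_pos_of_pos ?_ _) (by linarith))
      (by positivity)
    exact lt_max_of_lt_left (by linarith)
  have hc : inner ℝ ξ η = ‖ξ‖ * ‖η‖ := by
    have : (max (‖ξ‖ - 1) 0 ^ α / ‖ξ‖ + max (‖η‖ - 1) 0 ^ α / ‖η‖) *
      (‖ξ‖ * ‖η‖ - inner ℝ ξ η) = 0 := by linarith
    linarith [(mul_eq_zero.1 this).resolve_left hA.ne']
  have hz : ‖ξ - η‖ ^ 2 = 0 := by
    rw [norm_sub_sq_real, hc, hst]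
    ring
  rw [sub_eq_zero.1 (norm_eq_zero.1 (pow_eq_zero_iff two_ne_zero |>.1 hz))]

variable {Ω : TopologicalSpace.Opens (RN N)}

/-- The growth `|H_{p-1}(ξ)| ≤ |ξ|^{p-1}` puts the flux in the dual Lebesgue space, so that the weak
equation can be tested with limits of test functions. -/
theorem memLp_fieldH {p : ℝ} (hp : 1 < p) {μ : Measure (RN N)} {G : RN N → RN N}
    (hG : MemLp G (ENNReal.ofReal p) μ) :
    MemLp (fun x => fieldH (p - 1) (G x)) (ENNReal.ofReal (p / (p - 1))) μ := by
  have h := hG.norm_rpow_div (ENNReal.ofReal (p - 1))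
  rw [← ENNReal.ofReal_div_of_pos (by linarith), ENNReal.toReal_ofReal (by linarith)] at h
  refine h.mono (((measurable_fieldH _).comp_aemeasurable hG.1.aemeasurable).aestronglyMeasurable)
    (.of_forall fun x => ?_)
  exact (norm_fieldH_le (by linarith) _).trans (le_abs_self _)

theorem holderConjugate_ofReal {p : ℝ} (hp : 1 < p) :
    ENNReal.HolderConjugate (ENNReal.ofReal (p / (p - 1))) (ENNReal.ofReal p) :=
  (Real.HolderConjugate.conjExponent hp).symm.ennrealOfReal

theorem lintegral_enorm_inner_le {p : ℝ} (hp : 1 < p) {μ : Measure (RN N)} {F G : RN N → RN N}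
    (hF : AEStronglyMeasurable F μ) (hG : AEStronglyMeasurable G μ) :
    ∫⁻ x, ‖inner ℝ (F x) (G x)‖ₑ ∂μ ≤
      eLpNorm F (ENNReal.ofReal (p / (p - 1))) μ * eLpNorm G (ENNReal.ofReal p) μ := by
  have := holderConjugate_ofReal hp
  have h := eLpNorm_le_eLpNorm_mul_eLpNorm_of_nnnorm (r := 1) (p := ENNReal.ofReal (p / (p - 1)))
    (q := ENNReal.ofReal p) hF hG (fun a b => inner ℝ a b) 1
    (.of_forall fun x => by rw [one_mul]; exact nnnorm_inner_le_nnnorm _ _)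
  rwa [eLpNorm_one_eq_lintegral_enorm, ENNReal.coe_one, one_mul] at h

theorem integrable_inner_of_memLp {p : ℝ} (hp : 1 < p) {μ : Measure (RN N)} {F G : RN N → RN N}
    (hF : MemLp F (ENNReal.ofReal (p / (p - 1))) μ) (hG : MemLp G (ENNReal.ofReal p) μ) :
    Integrable (fun x => inner ℝ (F x) (G x)) μ :=
  ⟨hF.1.inner hG.1, (lintegral_enorm_inner_le hp hF.1 hG.1).trans_lt
    (ENNReal.mul_lt_top hF.2 hG.2)⟩

theorem TestFunction.memLp_gradient (φ : TestFunction Ω ℝ ⊤) (q : ℝ≥0∞) :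
    MemLp (gradient φ) q (leb Ω) :=
  (φ.continuous_gradient.memLp_of_hasCompactSupport φ.hasCompactSupport_gradient).restrict _

theorem integral_inner_eq_zero_of_tendsto {p : ℝ} (hp : 1 < p) {D G : RN N → RN N}
    (hD : MemLp D (ENNReal.ofReal (p / (p - 1))) (leb Ω))
    (hG : MemLp G (ENNReal.ofReal p) (leb Ω))
    (h0 : ∀ φ : TestFunction Ω ℝ ⊤, ∫ x in (Ω : Set (RN N)), inner ℝ (D x) (gradient φ x) = 0)
    {φ : ℕ → TestFunction Ω ℝ ⊤}
    (hφ : Tendsto (fun n => eLpNorm (fun x => G x - gradient (φ n) x) (ENNReal.ofReal p) (leb Ω))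
      atTop (𝓝 0)) :
    ∫ x in (Ω : Set (RN N)), inner ℝ (D x) (G x) = 0 := by
  have hi := fun n => integrable_inner_of_memLp hp hD ((φ n).memLp_gradient (ENNReal.ofReal p))
  have ht : Tendsto (fun n => ∫ x in (Ω : Set (RN N)), inner ℝ (D x) (gradient (φ n) x)) atTop
      (𝓝 (∫ x in (Ω : Set (RN N)), inner ℝ (D x) (G x))) := by
    refine tendsto_integral_of_L1 _ (integrable_inner_of_memLp hp hD hG).1 (.of_forall hi) ?_
    have h2 := ENNReal.Tendsto.const_mul hφ (Or.inr hD.2.ne)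
    rw [mul_zero] at h2
    refine tendsto_of_tendsto_of_tendsto_of_le_of_le tendsto_const_nhds h2 (fun _ => zero_le) ?_
    intro n
    refine le_trans (le_of_eq ?_) (lintegral_enorm_inner_le hp hD.1
      (hG.1.sub ((φ n).memLp_gradient (ENNReal.ofReal p)).1))
    refine lintegral_congr fun x => ?_
    rw [inner_sub_right, enorm_sub_rev]
  simp only [h0] at ht
  exact tendsto_nhds_unique tendsto_const_nhds ht |>.symm

/-- The fields `H_β(∇u)` of a weak solution `u` are uniquely determined. -/
theorem fieldH_ae_eq_of_integral_inner_eq {p : ℝ} (hp : 1 < p) {G₁ G₂ : RN N → RN N}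
    (h₁ : MemLp G₁ (ENNReal.ofReal p) (leb Ω)) (h₂ : MemLp G₂ (ENNReal.ofReal p) (leb Ω))
    {φ₁ φ₂ : ℕ → TestFunction Ω ℝ ⊤}
    (ht₁ : Tendsto (fun n => eLpNorm (fun x => G₁ x - gradient (φ₁ n) x) (ENNReal.ofReal p)
      (leb Ω)) atTop (𝓝 0))
    (ht₂ : Tendsto (fun n => eLpNorm (fun x => G₂ x - gradient (φ₂ n) x) (ENNReal.ofReal p)
      (leb Ω)) atTop (𝓝 0))
    (h : ∀ φ : TestFunction Ω ℝ ⊤,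
      ∫ x in (Ω : Set (RN N)), inner ℝ (fieldH (p - 1) (G₁ x)) (gradient φ x)
        = ∫ x in (Ω : Set (RN N)), inner ℝ (fieldH (p - 1) (G₂ x)) (gradient φ x))
    {β : ℝ} (hβ : 0 < β) :
    (fun x => fieldH β (G₁ x)) =ᵐ[leb Ω] fun x => fieldH β (G₂ x) := by
  have hH₁ := memLp_fieldH hp h₁
  have hH₂ := memLp_fieldH hp h₂
  have hD : MemLp (fun x => fieldH (p - 1) (G₁ x) - fieldH (p - 1) (G₂ x))
      (ENNReal.ofReal (p / (p - 1))) (leb Ω) := hH₁.sub hH₂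
  have h0 : ∀ φ : TestFunction Ω ℝ ⊤, ∫ x in (Ω : Set (RN N)),
      inner ℝ (fieldH (p - 1) (G₁ x) - fieldH (p - 1) (G₂ x)) (gradient φ x) = 0 := by
    intro φ
    simp only [inner_sub_left]
    rw [integral_sub (integrable_inner_of_memLp hp hH₁ (φ.memLp_gradient _))
      (integrable_inner_of_memLp hp hH₂ (φ.memLp_gradient _)), h φ, sub_self]
  -- The equations are subtracted and tested with the difference of the two solutions, admissible by
  -- density; the integrand is non-negative, hence zero almost everywhere.
  have hz : ∫ x in (Ω : Set (RN N)),
      inner ℝ (fieldH (p - 1) (G₁ x) - fieldH (p - 1) (G₂ x)) (G₁ x - G₂ x) = 0 := by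
    simp only [inner_sub_right _ (G₁ _)]
    rw [integral_sub (integrable_inner_of_memLp hp hD h₁) (integrable_inner_of_memLp hp hD h₂),
      integral_inner_eq_zero_of_tendsto hp hD h₁ h0 ht₁,
      integral_inner_eq_zero_of_tendsto hp hD h₂ h0 ht₂, sub_self]
  rw [integral_eq_zero_iff_of_nonneg
    (fun x => inner_fieldH_sub_nonneg (by linarith) _ _)
    (integrable_inner_of_memLp hp hD (h₁.sub h₂))] at hz
  filter_upwards [hz] with x hx
  exact fieldH_eq_of_inner_sub_eq_zero (by linarith) hx hβ

end Monotone

/-! ### Weak Lebesgue spaces and power bounds -/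

section Lorentz

variable {N : ℕ}

theorem volume_real_ball (R : ℝ) (hR : 0 < R) : volume (Metric.ball (0 : RN N) R) =
    ENNReal.ofReal (R ^ N * volume.real (Metric.ball (0 : RN N) 1)) := by
  rw [Measure.addHaar_ball_of_pos _ _ hR, finrank_euclideanSpace_fin,
    ENNReal.ofReal_mul (pow_nonneg hR.le _), Measure.real, ENNReal.ofReal_toReal measure_ball_lt_top.ne]

theorem volume_real_unitBall_pos : 0 < volume.real (Metric.ball (0 : RN N) 1) :=
  ENNReal.toReal_pos (Metric.measure_ball_pos _ _ one_pos).ne' measure_ball_lt_top.ne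

/-- A radially decreasing function of class `L^{r,∞}` is bounded by a multiple of `|x|^{-N/r}`. -/
theorem exists_le_rpow_of_memLorentz (hN : N ≠ 0) {R r : ℝ} {f : RN N → ℝ}
    (hf : MemLorentz (openBall N R) r f) {g : ℝ → ℝ} (hg : AntitoneOn g (Ioo 0 R))
    (hg0 : ∀ s ∈ Ioo 0 R, 0 ≤ g s) (hfg : ∀ᵐ x ∂(leb (openBall N R)), f x = g ‖x‖) :
    ∃ C : ℝ, 0 ≤ C ∧ ∀ s ∈ Ioo 0 R, g s ≤ C * s ^ (-((N : ℝ) / r)) := by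
  set ω := volume.real (Metric.ball (0 : RN N) 1) with hω
  have hω0 : 0 < ω := volume_real_unitBall_pos
  set L := (lorentzNorm (openBall N R) r f).toReal with hL
  refine ⟨L * ω ^ (-(1 / r)), mul_nonneg ENNReal.toReal_nonneg (Real.rpow_nonneg hω0.le _),
    fun s hs => ?_⟩
  -- The volume of the ball of radius `s`. There `f ≥ g(s)` almost everywhere, so `f* ≥ g(s)` on
  -- `(0, m)` and `f**(m) ≥ g(s)`; the Lorentz norm is then read off at `t = m`.
  set m := s ^ N * ω with hm
  have hm0 : 0 < m := mul_pos (pow_pos hs.1 _) hω0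
  have hdist : ∀ τ < ENNReal.ofReal (g s), ENNReal.ofReal m ≤ distribFun (openBall N R) f τ := by
    intro τ hτ
    rw [hm, hω, ← volume_real_ball s hs.1, distribFun]
    have hsub : Metric.ball (0 : RN N) s ⊆ (openBall N R : Set (RN N)) :=
      Metric.ball_subset_ball hs.2.le
    rw [← Measure.restrict_eq_self (volume : Measure (RN N)) hsub]
    refine measure_mono_ae ?_
    filter_upwards [hfg, ae_norm_mem_Ioo hN R] with x hx hxR hxs
    have hxs' : ‖x‖ < s := by simpa using mem_ball_zero_iff.1 hxs
    change τ < ‖f x‖ₑ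
    rw [hx, Real.enorm_eq_ofReal (hg0 _ hxR)]
    exact hτ.trans_le (ENNReal.ofReal_le_ofReal (hg hxR hs hxs'.le))
  have hrearr : ∀ σ ∈ Ioo 0 m, ENNReal.ofReal (g s) ≤ decRearr (openBall N R) f σ := by
    intro σ hσ
    refine le_sInf fun τ hτ => ?_
    by_contra! h
    have h1 := (hdist τ h).trans hτ
    rw [ENNReal.ofReal_le_ofReal_iff hσ.1.le] at h1
    exact absurd hσ.2 (not_lt.2 h1)
  have hmax : ENNReal.ofReal (g s) ≤ maxRearr (openBall N R) f m := by
    calc ENNReal.ofReal (g s)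
        = (ENNReal.ofReal m)⁻¹ * ∫⁻ _ in Ioo 0 m, ENNReal.ofReal (g s) := by
          rw [lintegral_const, Measure.restrict_apply_univ, Real.volume_Ioo, sub_zero,
            mul_comm (ENNReal.ofReal (g s)), ← mul_assoc,
            ENNReal.inv_mul_cancel (by simpa using hm0) ENNReal.ofReal_ne_top, one_mul]
      _ ≤ _ := by
          rw [maxRearr]
          gcongr 1
          exact setLIntegral_mono' measurableSet_Ioo hrearr
  have hnorm : ENNReal.ofReal (m ^ (1 / r)) * ENNReal.ofReal (g s) ≤
      lorentzNorm (openBall N R) r f := by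
    refine (mul_le_mul_right hmax _).trans ?_
    exact le_iSup₂ (f := fun t (_ : t ∈ Ioi (0 : ℝ)) =>
      ENNReal.ofReal (t ^ (1 / r)) * maxRearr (openBall N R) f t) m hm0
  rw [← ENNReal.ofReal_mul (Real.rpow_nonneg hm0.le _),
    ENNReal.ofReal_le_iff_le_toReal hf.2.ne, ← hL, hm,
    Real.mul_rpow (pow_nonneg hs.1.le _) hω0.le, ← Real.rpow_natCast, ← Real.rpow_mul hs.1.le,
    mul_one_div] at hnorm
  have h1 : 0 < s ^ ((N : ℝ) / r) := Real.rpow_pos_of_pos hs.1 _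
  have h2 : 0 < ω ^ (1 / r) := Real.rpow_pos_of_pos hω0 _
  rw [Real.rpow_neg hω0.le, Real.rpow_neg hs.1.le, ← div_eq_mul_inv, ← div_eq_mul_inv,
    le_div_iff₀ h1, le_div_iff₀ h2]
  linarith

/-- On a bounded ball `|x|^{-β}` is dominated by a multiple of `|x|^{-N/r}`, whose rearrangement is
a multiple of `s^{-1/r}`; the latter is integrable at zero because `r > 1`. -/
theorem memLorentz_norm_rpow_neg (hN : N ≠ 0) {R r β : ℝ} (hR : 0 < R) (hr : 1 < r)
    (hβ : β ≤ N / r) : MemLorentz (openBall N R) r (fun x => ‖x‖ ^ (-β)) := by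
  have hN' : (0 : ℝ) < N := by exact_mod_cast Nat.pos_of_ne_zero hN
  refine ⟨(measurable_norm.pow_const _).aestronglyMeasurable, ?_⟩
  set ω := volume.real (Metric.ball (0 : RN N) 1) with hω
  have hω0 : 0 < ω := volume_real_unitBall_pos
  set C := R ^ ((N : ℝ) / r - β) with hC
  have hC0 : 0 < C := Real.rpow_pos_of_pos hR _
  have hr0 : 0 < r := by linarith
  have hr1 : 1 / r < 1 := by rw [div_lt_one hr0]; exact hr
  have hrearr : ∀ s, 0 < s → decRearr (openBall N R) (fun x => ‖x‖ ^ (-β)) s ≤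
      ENNReal.ofReal (C * ω ^ (1 / r) * s ^ (-(1 / r))) := by
    intro s hs
    refine sInf_le ?_
    change distribFun _ _ _ ≤ _
    set ρ := (s / ω) ^ (1 / (N : ℝ)) with hρ
    have hρ0 : 0 < ρ := Real.rpow_pos_of_pos (div_pos hs hω0) _
    have hball : ENNReal.ofReal s = volume (Metric.ball (0 : RN N) ρ) := by
      rw [volume_real_ball ρ hρ0, ← hω, hρ, ← Real.rpow_natCast, ← Real.rpow_mul
        (div_pos hs hω0).le, one_div_mul_cancel hN'.ne', Real.rpow_one, div_mul_cancel₀ _ hω0.ne']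
    have hval : C * ω ^ (1 / r) * s ^ (-(1 / r)) = C * ρ ^ (-((N : ℝ) / r)) := by
      rw [hρ, ← Real.rpow_mul (div_pos hs hω0).le, mul_assoc]
      congr 1
      rw [show 1 / (N : ℝ) * -((N : ℝ) / r) = -(1 / r) by field_simp,
        Real.div_rpow hs.le hω0.le, Real.rpow_neg hω0.le, div_inv_eq_mul, mul_comm]
    rw [hval, hball, distribFun]
    refine le_trans (measure_mono_ae ?_) (Measure.restrict_apply_le _ _)
    filter_upwards [ae_norm_mem_Ioo hN R] with x hx hxs
    change x ∈ Metric.ball 0 ρ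
    rw [mem_ball_zero_iff]
    have hxs' : ENNReal.ofReal (C * ρ ^ (-((N : ℝ) / r))) < ‖(‖x‖ ^ (-β))‖ₑ := hxs
    rw [Real.enorm_eq_ofReal (Real.rpow_nonneg (norm_nonneg _) _),
      ENNReal.ofReal_lt_ofReal_iff (Real.rpow_pos_of_pos hx.1 _)] at hxs'
    have h1 : ‖x‖ ^ (-β) ≤ C * ‖x‖ ^ (-((N : ℝ) / r)) := by
      calc ‖x‖ ^ (-β) = ‖x‖ ^ ((N : ℝ) / r - β) * ‖x‖ ^ (-((N : ℝ) / r)) := by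
            rw [← Real.rpow_add hx.1]; congr 1; ring
        _ ≤ _ := by
            have := Real.rpow_le_rpow hx.1.le hx.2.le (sub_nonneg.2 hβ)
            gcongr
    have h2 := lt_of_mul_lt_mul_left (hxs'.trans_le h1) hC0.le
    by_contra! h3
    exact absurd h2 (not_lt.2 (Real.rpow_le_rpow_of_nonpos hρ0 h3
      (neg_nonpos.2 (by positivity))))
  refine lt_of_le_of_lt (b := ENNReal.ofReal (C * ω ^ (1 / r) / (1 - 1 / r))) ?_
    ENNReal.ofReal_lt_top
  refine iSup₂_le fun t ht => ?_
  have ht0 : 0 < t := ht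
  have hint : IntervalIntegrable (fun s : ℝ => C * ω ^ (1 / r) * s ^ (-(1 / r))) volume 0 t :=
    (intervalIntegral.intervalIntegrable_rpow' (by linarith)).const_mul _
  have h1 : ∫⁻ s in Ioo 0 t, decRearr (openBall N R) (fun x => ‖x‖ ^ (-β)) s ≤
      ENNReal.ofReal (C * ω ^ (1 / r) / (1 - 1 / r) * t ^ (1 - 1 / r)) := by
    calc _ ≤ ∫⁻ s in Ioo 0 t, ENNReal.ofReal (C * ω ^ (1 / r) * s ^ (-(1 / r))) :=
          setLIntegral_mono' measurableSet_Ioo fun s hs => hrearr s hs.1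
      _ = ENNReal.ofReal (∫ s in Ioo 0 t, C * ω ^ (1 / r) * s ^ (-(1 / r))) := by
          rw [ofReal_integral_eq_lintegral_ofReal
            ((intervalIntegrable_iff_integrableOn_Ioo_of_le ht0.le).1 hint)]
          filter_upwards [ae_restrict_mem measurableSet_Ioo] with s hs
          exact mul_nonneg (by positivity) (Real.rpow_nonneg hs.1.le _)
      _ = _ := by
          rw [← integral_Ioc_eq_integral_Ioo, ← intervalIntegral.integral_of_le ht0.le,
            intervalIntegral.integral_const_mul, integral_rpow (Or.inl (by linarith)),
            neg_add_eq_sub, Real.zero_rpow (by linarith), sub_zero]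
          congr 1
          ring
  calc _ ≤ ENNReal.ofReal (t ^ (1 / r)) * ((ENNReal.ofReal t)⁻¹ *
        ENNReal.ofReal (C * ω ^ (1 / r) / (1 - 1 / r) * t ^ (1 - 1 / r))) := by
        rw [maxRearr]
        gcongr
    _ = _ := by
        rw [← ENNReal.ofReal_inv_of_pos ht0, ← ENNReal.ofReal_mul (by positivity),
          ← ENNReal.ofReal_mul (by positivity)]
        congr 1
        rw [Real.rpow_sub ht0, Real.rpow_one]
        have := (Real.rpow_pos_of_pos ht0 (1 / r)).ne'
        have : 1 - 1 / r ≠ 0 := by linarith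
        field_simp

end Lorentz

/-! ### The explicit radial solution -/

section RadialSolution

variable {N : ℕ}

theorem integrable_norm_rpow_openBall_iff (hN : N ≠ 0) {R : ℝ} (hR : 0 < R) (a : ℝ) :
    Integrable (fun x : RN N => ‖x‖ ^ a) (leb (openBall N R)) ↔ -(N : ℝ) < a := by
  have : Nonempty (Fin N) := ⟨⟨0, Nat.pos_of_ne_zero hN⟩⟩
  have h := integrableOn_fun_norm_addHaar (volume : Measure (RN N)) (f := fun s : ℝ => s ^ a)
    (r := R)
  rw [finrank_euclideanSpace_fin] at h
  refine h.trans ?_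
  rw [integrableOn_congr_fun (g := fun s : ℝ => s ^ ((N : ℝ) - 1 + a)) ?_ measurableSet_Ioo,
    intervalIntegral.integrableOn_Ioo_rpow_iff hR]
  · constructor <;> intro h <;> linarith
  · intro s hs
    simp only [smul_eq_mul]
    rw [Real.rpow_add hs.1, ← Real.rpow_natCast, Nat.cast_sub (Nat.one_le_iff_ne_zero.2 hN),
      Nat.cast_one]

theorem memLp_norm_rpow_openBall_iff (hN : N ≠ 0) {R : ℝ} (hR : 0 < R) {q : ℝ} (hq : 0 < q)
    (a : ℝ) : MemLp (fun x : RN N => ‖x‖ ^ a) (ENNReal.ofReal q) (leb (openBall N R)) ↔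
      -(N : ℝ) < a * q := by
  have hm : AEStronglyMeasurable (fun x : RN N => ‖x‖ ^ a) (leb (openBall N R)) :=
    (measurable_norm.pow_const a).aestronglyMeasurable
  rw [← integrable_norm_rpow_iff hm (by simpa using hq) ENNReal.ofReal_ne_top,
    ENNReal.toReal_ofReal hq.le, ← integrable_norm_rpow_openBall_iff hN hR]
  refine integrable_congr (.of_forall fun x => ?_)
  simp only
  rw [Real.norm_of_nonneg (Real.rpow_nonneg (norm_nonneg _) _), ← Real.rpow_mul (norm_nonneg _)]

theorem fluxFactor_eq {g : ℝ → ℝ} {ρ : ℝ} (hρ : 0 < ρ) (hM : 0 ≤ radialMass N g ρ) (θ : ℝ) :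
    fluxFactor N g θ ρ = -(ρ⁻¹ * (ρ ^ (1 - (N : ℝ)) * radialMass N g ρ) ^ θ) := by
  rw [fluxFactor, Real.mul_rpow (Real.rpow_nonneg hρ.le _) hM, ← Real.rpow_mul hρ.le,
    ← Real.rpow_neg_one, ← mul_assoc, ← Real.rpow_add hρ]
  congr 3
  ring

/-- The modulus of the gradient of the radial solution. -/
noncomputable def solutionSlope (N : ℕ) (p : ℝ) (g : ℝ → ℝ) (s : ℝ) : ℝ :=
  1 - s * fluxFactor N g (1 / (p - 1)) s

/-- The gradient of the radial solution. -/
noncomputable def solutionGradient (N : ℕ) (p : ℝ) (g : ℝ → ℝ) (x : RN N) : RN N :=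
  (-solutionSlope N p g ‖x‖ / ‖x‖) • x

namespace IsRadialProfile

variable {b C R p : ℝ} {g : ℝ → ℝ}

/-- With `v = |x|^{1-N} M(|x|)`, the gradient has modulus `1 + v^{1/(p-1)}`. Subtracting the
threshold one leaves a pure power, so `H_α` turns it into `v^{α/(p-1)}`. -/
theorem fieldH_solutionGradient (hg : IsRadialProfile b C g) {α : ℝ}
    {x : RN N} (hx : x ≠ 0) :
    fieldH α (solutionGradient N p g x) = fluxFactor N g (α / (p - 1)) ‖x‖ • x := by
  have hn : 0 < ‖x‖ := norm_pos_iff.2 hx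
  have hM := hg.radialMass_nonneg (N := N) hn.le
  set v := ‖x‖ ^ (1 - (N : ℝ)) * radialMass N g ‖x‖ with hv
  have hv0 : 0 ≤ v := mul_nonneg (Real.rpow_nonneg hn.le _) hM
  have hs : solutionSlope N p g ‖x‖ = 1 + v ^ (1 / (p - 1)) := by
    rw [solutionSlope, fluxFactor_eq hn hM, ← hv]
    field_simp
    ring
  have hw : 0 ≤ v ^ (1 / (p - 1)) := Real.rpow_nonneg hv0 _
  have hnorm : ‖solutionGradient N p g x‖ = 1 + v ^ (1 / (p - 1)) := by
    rw [solutionGradient, hs, norm_smul, norm_div, norm_neg, norm_norm,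
      Real.norm_of_nonneg (by linarith), div_mul_cancel₀ _ hn.ne']
  rw [fieldH_eq_smul, hnorm, add_sub_cancel_left, max_eq_left hw, ← Real.rpow_mul hv0,
    solutionGradient, hs, smul_smul, fluxFactor_eq hn hM, ← hv, one_div_mul_eq_div]
  congr 1
  have : 1 + v ^ (1 / (p - 1)) ≠ 0 := by positivity
  field_simp

theorem measurable_solutionSlope (hg : IsRadialProfile b C g) (hN : N ≠ 0) (hb : b < N) (p : ℝ) :
    Measurable (solutionSlope N p g) :=
  measurable_const.sub (measurable_id.mul (hg.measurable_fluxFactor hN hb _))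

theorem memLp_solutionSlope (hg : IsRadialProfile b C g) (hN : N ≠ 0) (hb : b < N) (hR : 0 < R)
    (hp : 1 < p) (hbp : -(N : ℝ) < (1 - b) * (p / (p - 1))) :
    MemLp (fun x : RN N => solutionSlope N p g ‖x‖) (ENNReal.ofReal p) (leb (openBall N R)) := by
  have hθ : 0 < 1 / (p - 1) := one_div_pos.2 (by linarith)
  have h1 : MemLp (fun x : RN N => ‖x‖ ^ (1 / (p - 1) * (1 - b))) (ENNReal.ofReal p)
      (leb (openBall N R)) := by
    rw [memLp_norm_rpow_openBall_iff hN hR (by linarith)]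
    convert hbp using 1
    ring
  refine (memLp_const 1).sub ((h1.const_mul ((C / (N - b)) ^ (1 / (p - 1)))).mono ?_ ?_)
  · exact ((measurable_id.mul (hg.measurable_fluxFactor hN hb _)).comp
      measurable_norm).aestronglyMeasurable
  · filter_upwards [ae_norm_mem_Ioo hN R] with x hx
    rw [norm_mul, norm_norm]
    refine le_trans ?_ (le_abs_self _)
    calc ‖x‖ * |fluxFactor N g (1 / (p - 1)) ‖x‖|
        ≤ ‖x‖ * ((C / (N - b)) ^ (1 / (p - 1)) * ‖x‖ ^ (-1 + 1 / (p - 1) * (1 - b))) := by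
          gcongr
          exact hg.abs_fluxFactor_le hN hb hθ hx.1
      _ = _ := by
          rw [Real.rpow_add hx.1, Real.rpow_neg_one]
          have := hx.1.ne'
          field_simp

theorem isWeakGradient_fluxFactor (hg : IsRadialProfile b C g) (hN : N ≠ 0) (hb : b < N)
    (hR : 0 < R) {θ : ℝ} (hθ : 0 < θ) (hbθ : -(N : ℝ) < -1 + θ * (1 - b)) (i : Fin N) :
    IsWeakGradient (openBall N R) (fun x => x i * fluxFactor N g θ ‖x‖)
      (fun x => fluxFactor N g θ ‖x‖ • EuclideanSpace.single i 1 +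
        x i • (fluxFactorDeriv N g θ ‖x‖ / ‖x‖) • x) := by
  refine isWeakGradient_coord_mul_radial hN hR (c := fluxFactor N g θ R)
    (hg.measurable_fluxFactorDeriv hN hb θ) ?_
    (fun ρ hρ => hg.fluxFactor_eq_sub_integral hN hb hθ hρ.1 hρ.2.le) i
  have h1 := (integrable_norm_rpow_openBall_iff hN hR _).2 hbθ
  have h2 : Integrable (fun x : RN N => ‖x‖ * fluxFactorDeriv N g θ ‖x‖) (leb (openBall N R)) := by
    refine (h1.const_mul ((1 + 2 * θ * N) * (C / (N - b)) ^ θ)).mono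
      ((measurable_id.mul (hg.measurable_fluxFactorDeriv hN hb θ)).comp
        measurable_norm).aestronglyMeasurable ?_
    filter_upwards [ae_norm_mem_Ioo hN R] with x hx
    refine (hg.abs_mul_fluxFactorDeriv_le hN hb hθ hx.1).trans (le_trans ?_ (le_abs_self _))
    rw [mul_assoc (1 + 2 * θ * (N : ℝ))]
    exact mul_le_mul_of_nonneg_left (hg.abs_fluxFactor_le hN hb hθ hx.1) (by positivity)
  exact h2.2

/-- The divergence of `W(|x|) x`, as the trace of its Jacobian. It serves twice: at `θ = 1` for the
equation, and at `θ = p/(2(p-1))` to detect the failure of regularity. -/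
theorem sum_weakGradient_fluxFactor (g : ℝ → ℝ) (θ : ℝ) {x : RN N} (hx : x ≠ 0) :
    ∑ i, (fluxFactor N g θ ‖x‖ • (EuclideanSpace.single i 1 : RN N) +
      x i • (fluxFactorDeriv N g θ ‖x‖ / ‖x‖) • x) i =
      N * fluxFactor N g θ ‖x‖ + ‖x‖ * fluxFactorDeriv N g θ ‖x‖ := by
  have hn : ‖x‖ ≠ 0 := norm_ne_zero_iff.2 hx
  simp only [PiLp.add_apply, PiLp.smul_apply, PiLp.single_apply, smul_eq_mul, if_true, mul_one]
  rw [Finset.sum_add_distrib, Finset.sum_const, Finset.card_univ, Fintype.card_fin, nsmul_eq_mul]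
  congr 1
  calc ∑ i, x i * (fluxFactorDeriv N g θ ‖x‖ / ‖x‖ * x i)
      = (∑ i, x i ^ 2) * (fluxFactorDeriv N g θ ‖x‖ / ‖x‖) := by
        rw [Finset.sum_mul]
        exact Finset.sum_congr rfl fun i _ => by ring
    _ = _ := by
        rw [← EuclideanSpace.real_norm_sq_eq]
        field_simp

/-- For `θ = 1` the factor is `-ρ^{-N} M`, so the two terms containing `M` cancel and only `-ρ^{1-N}
M' = -g` survives. -/
theorem divergence_fluxFactor_one (hN : N ≠ 0) (g : ℝ → ℝ) {ρ : ℝ} (hρ : 0 < ρ) :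
    N * fluxFactor N g 1 ρ + ρ * fluxFactorDeriv N g 1 ρ = -g ρ := by
  have e0 : (-1 - 1 * ((N : ℝ) - 1)) = -N := by ring
  rw [fluxFactor, fluxFactorDeriv, e0, sub_self, Real.rpow_zero, Real.rpow_one,
    Real.rpow_sub_one hρ.ne', Real.rpow_neg hρ.le, Real.rpow_natCast]
  have h1 : ρ ^ N = ρ * ρ ^ (N - 1) := (mul_pow_sub_one hN ρ).symm
  have h2 : ρ ^ (N - 1) ≠ 0 := (pow_pos hρ _).ne'
  rw [h1]
  field_simp
  ring

theorem integral_inner_fluxFactor_one (hg : IsRadialProfile b C g) (hN : N ≠ 0) (hb : b < N)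
    (hR : 0 < R) (φ : TestFunction (openBall N R) ℝ ⊤) :
    ∫ x in (openBall N R : Set (RN N)), inner ℝ (fluxFactor N g 1 ‖x‖ • x) (gradient φ x)
      = ∫ x in (openBall N R : Set (RN N)), g ‖x‖ * φ x := by
  have hw := hg.isWeakGradient_fluxFactor hN hb hR one_pos (by linarith)
  have e1 : ∀ x : RN N, inner ℝ (fluxFactor N g 1 ‖x‖ • x) (gradient φ x) =
      ∑ i, x i * fluxFactor N g 1 ‖x‖ * gradient φ x i := by
    intro x
    simp only [PiLp.inner_apply, PiLp.smul_apply, RCLike.inner_apply, conj_trivial, smul_eq_mul]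
    exact Finset.sum_congr rfl fun i _ => by ring
  simp only [e1]
  rw [integral_finsetSum _ fun i _ => (φ.integrable_mul_gradient i (hw i).1).restrict,
    Finset.sum_congr rfl fun i _ => (hw i).2.2 φ i, Finset.sum_neg_distrib,
    ← integral_finsetSum _ fun i _ =>
      (φ.integrable_mul (MeasureTheory.LocallyIntegrableOn.coord (hw i).2.1 i)).restrict,
    ← integral_neg]
  refine integral_congr_ae ?_
  filter_upwards [ae_norm_mem_Ioo hN R] with x hx
  rw [← Finset.sum_mul, sum_weakGradient_fluxFactor g 1 (norm_pos_iff.1 hx.1),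
    divergence_fluxFactor_one hN g hx.1]
  ring

theorem integral_inner_solutionGradient (hg : IsRadialProfile b C g) (hN : N ≠ 0) (hb : b < N)
    (hR : 0 < R) (hp : 1 < p) (φ : TestFunction (openBall N R) ℝ ⊤) :
    ∫ x in (openBall N R : Set (RN N)),
      inner ℝ (fieldH (p - 1) (solutionGradient N p g x)) (gradient φ x)
      = ∫ x in (openBall N R : Set (RN N)), g ‖x‖ * φ x := by
  rw [← hg.integral_inner_fluxFactor_one hN hb hR φ]
  refine integral_congr_ae ?_
  filter_upwards [ae_norm_mem_Ioo hN R] with x hx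
  rw [hg.fieldH_solutionGradient (norm_pos_iff.1 hx.1), div_self (by linarith)]

theorem isWeakSolution (hg : IsRadialProfile b C g) (hN : N ≠ 0) (hb : b < N)
    (hR : 0 < R) (hp : 1 < p) (hbp : -(N : ℝ) < (1 - b) * (p / (p - 1))) {f : RN N → ℝ}
    (hfg : ∀ᵐ x ∂(leb (openBall N R)), f x = g ‖x‖) :
    IsWeakSolution N R p f (radialPotential R (solutionSlope N p g)) (solutionGradient N p g) := by
  obtain ⟨h1, h2, h3, h4⟩ := radialPotential_memW1Zero hN hR hp.le
    (hg.measurable_solutionSlope hN hb p) (hg.memLp_solutionSlope hN hb hR hp hbp)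
  refine ⟨⟨h1, _, h2, h3, h4⟩, h2, fun φ => ?_⟩
  rw [hg.integral_inner_solutionGradient hN hb hR hp]
  refine integral_congr_ae ?_
  filter_upwards [hfg] with x hx
  rw [hx]

/-- The fields `H_α(∇u)` of every weak solution are those of the radial solution. -/
theorem fieldH_ae_eq (hg : IsRadialProfile b C g) (hN : N ≠ 0) (hb : b < N)
    (hR : 0 < R) (hp : 1 < p) (hbp : -(N : ℝ) < (1 - b) * (p / (p - 1))) {f : RN N → ℝ}
    (hfg : ∀ᵐ x ∂(leb (openBall N R)), f x = g ‖x‖) {u : RN N → ℝ} {G : RN N → RN N}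
    (hu : IsWeakSolution N R p f u G) {α : ℝ} (hα : 0 < α) :
    (fun x => fieldH α (G x)) =ᵐ[leb (openBall N R)]
      fun x => fluxFactor N g (α / (p - 1)) ‖x‖ • x := by
  obtain ⟨-, -, h3, φ, -, h4⟩ := radialPotential_memW1Zero hN hR hp.le
    (hg.measurable_solutionSlope hN hb p) (hg.memLp_solutionSlope hN hb hR hp hbp)
  obtain ⟨-, G', hG', hG'p, φ', -, h4'⟩ := hu.mem
  -- The gradient in the equation and the one approximated by test functions are given separately;
  -- uniqueness identifies them.
  have hGG' := hu.grad.ae_eq hG'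
  have heq : ∀ φ : TestFunction (openBall N R) ℝ ⊤,
      ∫ x in (openBall N R : Set (RN N)), inner ℝ (fieldH (p - 1) (G' x)) (gradient φ x)
        = ∫ x in (openBall N R : Set (RN N)),
          inner ℝ (fieldH (p - 1) (solutionGradient N p g x)) (gradient φ x) := by
    intro φ
    rw [(hg.isWeakSolution hN hb hR hp hbp hfg).eq φ, ← hu.eq φ]
    refine integral_congr_ae ?_
    filter_upwards [hGG'] with x hx
    rw [hx]
  have key := fieldH_ae_eq_of_integral_inner_eq hp hG'p h3 h4' h4 heq hα
  filter_upwards [key, hGG', ae_norm_mem_Ioo hN R] with x h1 h2 hx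
  rw [h2, h1]
  exact hg.fieldH_solutionGradient (norm_pos_iff.1 hx.1)

end IsRadialProfile

end RadialSolution

/-! ### Square integrability at and above the threshold -/

section Regularity

variable {N : ℕ}

theorem memLp_two_norm_rpow_openBall_iff (hN : N ≠ 0) {R : ℝ} (hR : 0 < R) (a : ℝ) :
    MemLp (fun x : RN N => ‖x‖ ^ a) 2 (leb (openBall N R)) ↔ -(N : ℝ) < a * 2 := by
  have h := memLp_norm_rpow_openBall_iff hN hR two_pos a
  rwa [ENNReal.ofReal_ofNat] at h

theorem IsRadialProfile.memLp_weakGradient_fluxFactor {b C R θ : ℝ} {g : ℝ → ℝ}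
    (hg : IsRadialProfile b C g) (hN : N ≠ 0) (hb : b < N) (hR : 0 < R) (hθ : 0 < θ)
    (hbθ : -(N : ℝ) < (-1 + θ * (1 - b)) * 2) (i : Fin N) :
    MemLp (fun x => x i * fluxFactor N g θ ‖x‖) 2 (leb (openBall N R)) ∧
    MemLp (fun x : RN N => fluxFactor N g θ ‖x‖ • (EuclideanSpace.single i 1 : RN N) +
        x i • (fluxFactorDeriv N g θ ‖x‖ / ‖x‖) • x) 2 (leb (openBall N R)) := by
  have hWm := (hg.measurable_fluxFactor hN hb θ).comp (measurable_norm (α := RN N))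
  have hkm := (hg.measurable_fluxFactorDeriv hN hb θ).comp (measurable_norm (α := RN N))
  have hxm : Measurable fun x : RN N => x i :=
    (EuclideanSpace.proj i : RN N →L[ℝ] ℝ).continuous.measurable
  have hxi : ∀ x : RN N, |x i| ≤ ‖x‖ := fun x => PiLp.norm_apply_le x i
  have hW : MemLp (fun x : RN N => fluxFactor N g θ ‖x‖) 2 (leb (openBall N R)) := by
    have h1 := (memLp_two_norm_rpow_openBall_iff hN hR _).2 hbθ
    refine (h1.const_mul ((C / (N - b)) ^ θ)).mono hWm.aestronglyMeasurable ?_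
    filter_upwards [ae_norm_mem_Ioo hN R] with x hx
    exact (hg.abs_fluxFactor_le hN hb hθ hx.1).trans (le_abs_self _)
  constructor
  · refine (hW.const_mul R).mono (hxm.mul hWm).aestronglyMeasurable ?_
    filter_upwards [ae_norm_mem_Ioo hN R] with x hx
    rw [norm_mul, norm_mul, Real.norm_of_nonneg hR.le]
    gcongr
    exact (hxi x).trans hx.2.le
  · refine (hW.const_mul (1 + (1 + 2 * θ * N))).mono ((hWm.smul_const _).add (hxm.smul
      ((hkm.div measurable_norm).smul measurable_id))).aestronglyMeasurable ?_
    filter_upwards [ae_norm_mem_Ioo hN R] with x hx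
    rw [norm_mul, Real.norm_of_nonneg (by positivity), add_mul, one_mul]
    refine (norm_add_le _ _).trans (add_le_add ?_ ?_)
    · simp [norm_smul]
    · refine le_trans ?_ (hg.abs_mul_fluxFactorDeriv_le hN hb hθ hx.1)
      rw [norm_smul, abs_mul, abs_norm]
      exact mul_le_mul (hxi x) (norm_div_norm_smul_le _ x) (norm_nonneg _) (norm_nonneg _)

theorem MemW1.congr_ae {Ω : TopologicalSpace.Opens (RN N)} {q : ℝ≥0∞} {u v : RN N → ℝ}
    (h : MemW1 Ω q u) (huv : u =ᵐ[leb Ω] v) : MemW1 Ω q v := by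
  obtain ⟨h1, G, h2, h3⟩ := h
  exact ⟨(memLp_congr_ae huv).1 h1, G, h2.congr_ae huv .rfl, h3⟩

/-- A non-negative non-increasing function on `(0, R)` bounded by a negative power extends by zero
to a radial profile. -/
theorem isRadialProfile_extend {R b C : ℝ} {g : ℝ → ℝ} (hg : AntitoneOn g (Ioo 0 R))
    (hg0 : ∀ s ∈ Ioo 0 R, 0 ≤ g s) (hC : 0 ≤ C) (hgb : ∀ s ∈ Ioo 0 R, g s ≤ C * s ^ (-b)) :
    IsRadialProfile b C ((Ioo 0 R).indicator g) := by
  have hnn : ∀ s, 0 ≤ (Ioo 0 R).indicator g s := indicator_nonneg hg0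
  have hanti : AntitoneOn ((Ioo 0 R).indicator g) (Ioi 0) := by
    intro s hs t ht hst
    by_cases h : t < R
    · have hs' : s ∈ Ioo 0 R := ⟨hs, hst.trans_lt h⟩
      have ht' : t ∈ Ioo 0 R := ⟨ht, h⟩
      rw [indicator_of_mem hs', indicator_of_mem ht']
      exact hg hs' ht' hst
    · rw [indicator_of_notMem (fun h' => h h'.2)]
      exact hnn s
  refine ⟨?_, hanti, hnn, fun s hs => indicator_of_notMem (fun h => not_lt.2 hs h.1) _,
    fun s hs => ?_⟩
  -- The profile decreases only on the half-line; the substitution `s = exp t` gives a globally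
  -- monotone, hence measurable, function.
  · have hexp : Antitone fun t => (Ioo 0 R).indicator g (Real.exp t) := fun t t' h =>
      hanti (Real.exp_pos t) (Real.exp_pos t') (Real.exp_le_exp.2 h)
    have h1 : Measurable ((Ioi (0 : ℝ)).indicator
        fun s => (Ioo 0 R).indicator g (Real.exp (Real.log s))) :=
      (hexp.measurable.comp Real.measurable_log).indicator measurableSet_Ioi
    convert h1 using 1
    funext s
    by_cases hs : 0 < s
    · rw [indicator_of_mem (s := Ioi (0 : ℝ)) (mem_Ioi.2 hs), Real.exp_log hs]
    · rw [indicator_of_notMem (s := Ioi (0 : ℝ)) (by simpa using hs),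
        indicator_of_notMem (fun h => hs h.1)]
  · by_cases h : s ∈ Ioo 0 R
    · rw [indicator_of_mem h]
      exact hgb s h
    · rw [indicator_of_notMem h]
      exact mul_nonneg hC (Real.rpow_nonneg hs.le _)

theorem isRadialProfile_rpow_neg {β : ℝ} (hβ : 0 < β) :
    IsRadialProfile β 1 ((Ioi (0 : ℝ)).indicator fun s => s ^ (-β)) := by
  refine ⟨(measurable_id.pow_const _).indicator measurableSet_Ioi, fun s hs t ht hst => ?_,
    indicator_nonneg fun s hs => Real.rpow_nonneg (le_of_lt hs) _,
    fun s hs => indicator_of_notMem (by simpa using hs) _, fun s hs => ?_⟩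
  · rw [indicator_of_mem hs, indicator_of_mem ht]
    exact Real.rpow_le_rpow_of_nonpos hs hst (by linarith)
  · rw [indicator_of_mem (mem_Ioi.2 hs), one_mul]

theorem radialMass_rpow_neg (hN : N ≠ 0) {β : ℝ} (hβ : β < N) {ρ : ℝ} (hρ : 0 < ρ) :
    radialMass N ((Ioi (0 : ℝ)).indicator fun s => s ^ (-β)) ρ =
      ρ ^ ((N : ℝ) - β) / (N - β) := by
  have hne : (N : ℝ) - β ≠ 0 := by linarith
  rw [radialMass, intervalIntegral.integral_of_le hρ.le,
    setIntegral_congr_fun (g := fun s : ℝ => s ^ ((N : ℝ) - β - 1)) measurableSet_Ioc,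
    ← intervalIntegral.integral_of_le hρ.le, integral_rpow (Or.inl (by linarith)),
    sub_add_cancel, Real.zero_rpow hne, sub_zero]
  intro s hs
  simp only
  rw [indicator_of_mem (mem_Ioi.2 hs.1), ← Real.rpow_natCast, ← Real.rpow_add hs.1,
    Nat.cast_sub (Nat.one_le_iff_ne_zero.2 hN), Nat.cast_one]
  congr 1
  ring

/-- For a pure power `ρ^N g / M` is the constant `N - β`. The condition on `θ` makes `-1 + θ(1-β) =
-N/2` the exponent of `W`, and the divergence is `N/2` times `W`, so no cancellation hides the
singularity. -/
theorem divergence_fluxFactor_rpow_neg (hN : N ≠ 0) {β θ : ℝ} (hβ : β < N)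
    (hβθ : θ * (1 - β) = (2 - N) / 2) {ρ : ℝ} (hρ : 0 < ρ) :
    N * fluxFactor N ((Ioi (0 : ℝ)).indicator fun s => s ^ (-β)) θ ρ +
      ρ * fluxFactorDeriv N ((Ioi (0 : ℝ)).indicator fun s => s ^ (-β)) θ ρ =
      -(N / 2 * ((N - β)⁻¹) ^ θ) * ρ ^ (-(N / 2) : ℝ) := by
  have hd : (0 : ℝ) < N - β := by linarith
  set g := (Ioi (0 : ℝ)).indicator fun s : ℝ => s ^ (-β) with hg
  have hM := radialMass_rpow_neg hN hβ hρ
  rw [← hg] at hM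
  have hM0 : 0 < radialMass N g ρ := by
    rw [hM]
    exact div_pos (Real.rpow_pos_of_pos hρ _) hd
  have hW : fluxFactor N g θ ρ = -(((N - β)⁻¹) ^ θ * ρ ^ (-(N / 2) : ℝ)) := by
    rw [fluxFactor, hM, div_eq_mul_inv, Real.mul_rpow (Real.rpow_nonneg hρ.le _)
      (inv_nonneg.2 hd.le), ← Real.rpow_mul hρ.le, ← mul_assoc, ← Real.rpow_add hρ, mul_comm]
    congr 3
    linarith
  have hq : ρ ^ N * g ρ / radialMass N g ρ = N - β := by
    rw [hM, hg, indicator_of_mem (mem_Ioi.2 hρ), ← Real.rpow_natCast, ← Real.rpow_add hρ,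
      ← sub_eq_add_neg]
    have := (Real.rpow_pos_of_pos hρ ((N : ℝ) - β)).ne'
    field_simp
  rw [mul_fluxFactorDeriv hN θ hρ hM0, hq, ← add_mul,
    show (N : ℝ) + (-1 - θ * (N - 1) + θ * (N - β)) = N / 2 by linarith, hW]
  ring

end Regularity

/-! ### The threshold theorem -/

theorem theorem4 (N : ℕ) (hN : 2 ≤ N) (R : ℝ) (hR : 0 < R) (p : ℝ) (hp : 2 ≤ p) :
    (∀ r : ℝ, (N : ℝ) * p / ((N : ℝ) * (p - 1) + (2 - p)) < r →
      ∀ f : RN N → ℝ, RadiallyDecreasing N R f → MemLorentz (openBall N R) r f →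
      ∀ (u : RN N → ℝ) (G : RN N → RN N), IsWeakSolution N R p f u G →
        MemW1Vec (openBall N R) 2 (fun x => fieldH (p / 2) (G x))) ∧
    (∀ r : ℝ, 1 < r → r ≤ (N : ℝ) * p / ((N : ℝ) * (p - 1) + (2 - p)) →
      ∃ β : ℝ, 0 < β ∧
        RadiallyDecreasing N R (fun x => ‖x‖ ^ (-β)) ∧
        MemLorentz (openBall N R) r (fun x => ‖x‖ ^ (-β)) ∧
        (∃ (u : RN N → ℝ) (G : RN N → RN N), IsWeakSolution N R p (fun x => ‖x‖ ^ (-β)) u G) ∧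
        ∀ (u : RN N → ℝ) (G : RN N → RN N), IsWeakSolution N R p (fun x => ‖x‖ ^ (-β)) u G →
          ¬ MemW1Vec (openBall N R) 2 (fun x => fieldH (p / 2) (G x))) := by
  have hN0 : N ≠ 0 := by omega
  have hN2 : (2 : ℝ) ≤ N := by exact_mod_cast hN
  have hp1 : 0 < p - 1 := by linarith
  have hθ : 0 < p / 2 / (p - 1) := by positivity
  have hD : 0 < (N : ℝ) * (p - 1) + (2 - p) := by nlinarith
  have hDN : ((N : ℝ) * (p - 1) + (2 - p)) / p < N := by
    rw [div_lt_iff₀ (by linarith)]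
    nlinarith
  -- The subtracted fraction is `N/r₀`. The value `2 - N` is the borderline case of `2(-1 + θ(1-b))
  -- > -N` with `2θ = p/(p-1)`, which is how `r₀` arises.
  have hcrit : p / (p - 1) * (1 - ((N : ℝ) * (p - 1) + (2 - p)) / p) = 2 - N := by
    field_simp
    ring
  refine ⟨fun r hr f ⟨g, hg, hg0, hfg⟩ hfr u G hu i => ?_, fun r hr1 hr => ?_⟩
  · have hr0 : 0 < r := lt_of_le_of_lt (by positivity) hr
    have hb : (N : ℝ) / r < ((N : ℝ) * (p - 1) + (2 - p)) / p := by
      rw [div_lt_iff₀ hD] at hr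
      rw [div_lt_div_iff₀ hr0 (by linarith)]
      linarith
    have hkey : 2 - (N : ℝ) < p / (p - 1) * (1 - N / r) := by
      rw [← hcrit]
      gcongr
    obtain ⟨C, hC, hgC⟩ := exists_le_rpow_of_memLorentz hN0 hfr hg hg0 hfg
    have hprof := isRadialProfile_extend hg hg0 hC hgC
    have hfg' : ∀ᵐ x ∂(leb (openBall N R)), f x = (Ioo 0 R).indicator g ‖x‖ := by
      filter_upwards [hfg, ae_norm_mem_Ioo hN0 R] with x hx hxR
      rw [hx, indicator_of_mem hxR]
    have hbN : (N : ℝ) / r < N := hb.trans hDN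
    have hV := hprof.fieldH_ae_eq hN0 hbN hR (by linarith) (by linarith) hfg' hu
      (α := p / 2) (by linarith)
    have hbθ : -(N : ℝ) < (-1 + p / 2 / (p - 1) * (1 - N / r)) * 2 := by
      have : p / 2 / (p - 1) * (1 - (N : ℝ) / r) * 2 = p / (p - 1) * (1 - N / r) := by
        field_simp
      linarith
    obtain ⟨h1, h2⟩ := hprof.memLp_weakGradient_fluxFactor hN0 hbN hR hθ hbθ i
    refine MemW1.congr_ae (u := fun x => x i * fluxFactor N ((Ioo 0 R).indicator g)
      (p / 2 / (p - 1)) ‖x‖)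
      ⟨h1, _, hprof.isWeakGradient_fluxFactor hN0 hbN hR hθ (by linarith) i, h2⟩ ?_
    filter_upwards [hV] with x hx
    rw [hx, PiLp.smul_apply, smul_eq_mul, mul_comm]
  -- The exponent `N/r₀` serves all `r ≤ r₀` at once, since then `β ≤ N/r`.
  · set β := ((N : ℝ) * (p - 1) + (2 - p)) / p with hβ
    have hβ0 : 0 < β := by positivity
    have hfg : ∀ᵐ x ∂(leb (openBall N R)),
        ‖x‖ ^ (-β) = (Ioi (0 : ℝ)).indicator (fun s => s ^ (-β)) ‖x‖ := by
      filter_upwards [ae_norm_mem_Ioo hN0 R] with x hx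
      rw [indicator_of_mem (mem_Ioi.2 hx.1)]
    have hprof := isRadialProfile_rpow_neg hβ0
    have hbp : -(N : ℝ) < (1 - β) * (p / (p - 1)) := by linarith
    refine ⟨β, hβ0, ⟨fun s => s ^ (-β), ?_, fun s hs => Real.rpow_nonneg hs.1.le _,
      .of_forall fun x => rfl⟩, memLorentz_norm_rpow_neg hN0 hR hr1 ?_,
      ⟨_, _, hprof.isWeakSolution hN0 hDN hR (by linarith) hbp hfg⟩, fun u G hu hW => ?_⟩
    · exact fun s hs t _ hst => Real.rpow_le_rpow_of_nonpos hs.1 hst (by linarith)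
    · rw [le_div_iff₀ hD] at hr
      rw [hβ, div_le_div_iff₀ (by linarith) (by linarith)]
      linarith
    have hβθ : p / 2 / (p - 1) * (1 - β) = (2 - N) / 2 := by
      rw [← hcrit]
      field_simp
    have hV := hprof.fieldH_ae_eq hN0 hDN hR (by linarith) hbp hfg hu (α := p / 2) (by linarith)
    set g := (Ioi (0 : ℝ)).indicator fun s : ℝ => s ^ (-β)
    -- If the field were in `W^{1,2}`, uniqueness of weak gradients would put the explicit diagonal
    -- derivatives in `L²`, and with them their sum, the divergence.
    have hL : ∀ i, MemLp (fun x : RN N => (fluxFactor N g (p / 2 / (p - 1)) ‖x‖ •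
        (EuclideanSpace.single i 1 : RN N) +
        x i • (fluxFactorDeriv N g (p / 2 / (p - 1)) ‖x‖ / ‖x‖) • x) i) 2
        (leb (openBall N R)) := by
      intro i
      obtain ⟨-, Gi, hGi, hGi2⟩ := hW i
      have h1 := hprof.isWeakGradient_fluxFactor hN0 hDN hR hθ (by linarith) i
      have h2 : IsWeakGradient (openBall N R) (fun x => x i * fluxFactor N g
          (p / 2 / (p - 1)) ‖x‖) Gi := by
        refine hGi.congr_ae ?_ .rfl
        filter_upwards [hV] with x hx
        rw [hx, PiLp.smul_apply, smul_eq_mul, mul_comm]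
      have h3 := (memLp_congr_ae (h1.ae_eq h2)).2 hGi2
      refine h3.mono ?_ (.of_forall fun x => PiLp.norm_apply_le _ i)
      exact (EuclideanSpace.proj i : RN N →L[ℝ] ℝ).continuous.comp_aestronglyMeasurable h3.1
    have hsum := memLp_finsetSum' Finset.univ fun i _ => hL i
    set c := -((N : ℝ) / 2 * ((N - β)⁻¹) ^ (p / 2 / (p - 1))) with hc
    have hc0 : c ≠ 0 := by
      have : 0 < ((N - β)⁻¹) ^ (p / 2 / (p - 1)) :=
        Real.rpow_pos_of_pos (inv_pos.2 (by linarith)) _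
      rw [hc]
      exact neg_ne_zero.2 (by positivity)
    have hpow : MemLp (fun x : RN N => c * ‖x‖ ^ (-((N : ℝ) / 2))) 2 (leb (openBall N R)) := by
      refine (memLp_congr_ae ?_).1 hsum
      filter_upwards [ae_norm_mem_Ioo hN0 R] with x hx
      rw [Finset.sum_apply, IsRadialProfile.sum_weakGradient_fluxFactor g _ (norm_pos_iff.1 hx.1),
        divergence_fluxFactor_rpow_neg hN0 hDN hβθ hx.1]
    have hpow' := hpow.const_mul c⁻¹
    simp only [inv_mul_cancel_left₀ hc0] at hpow'
    -- Square integrability of `|x|^{-N/2}` would require `-N < -N`.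
    rw [memLp_two_norm_rpow_openBall_iff hN0 hR] at hpow'
    linarith
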